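/- **Theorem 5.4.** Let $n\ge 1$. *Exponential families.* For a positive (possibly unbounded) measure $\mu$ on $\mathbb R^n$ let $\Theta(\mu)$ be the interior of the set of $\theta\in\mathbb R^n$ with $\int e^{\langle\theta,x\rangle}\mu(dx)<\infty$, and let $\mathcal M(\mathbb R^n)$ be the set of $\mu$ such that $\Theta(\mu)\neq\emptyset$ and $\mu$ is not concentrated on an affine hyperplane. For $\mu\in\mathcal M(\mathbb R^n)$ and $\theta\in\Theta(\mu)$ let $P(\theta,\mu)$ be the probability proportional to $e^{\langle\theta,x\rangle}\mu(dx)$, and let $F=\{P(\theta,\mu):\theta\in\Theta(\mu)\}$ be the natural exponential family generated by $\mu$. Its domain of the means $M_F$ is the set of the means of the $P(\theta,\mu)$, and its variance function $V_F$ maps $m\in M_F$ to the covariance matrix of the element of $F$ of mean $m$. A variance function is always considered together with its domain $M_F$. *The action of $G$.* Let $G=GL(n+1,\mathbb R)$. For $g=\begin{pmatrix}A&b\\c^T&d\end{pmatrix}\in G$ (with $A$ of order $n$, $b,c\in\mathbb R^n$, $d\in\mathbb R$) put $h_g(m)=\frac{Am+b}{c^Tm+d}$, and for a function $V$ from $M\subset\mathbb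 R^n$ to the symmetric matrices of order $n$ put $$T_g(V)(m)=\frac1{c^Tm+d}\,h_g'(m)^{-1}\,V(h_g(m))\,(h_g'(m)^T)^{-1}\qquad\text{for } c^Tm+d>0,\ h_g(m)\in M .$$ The $G$-orbit of $V$ is the set of all variance functions $V_1$, with domain $M_1$, such that for some $g\in G$ the function $T_g(V)$ is defined on, and coincides with $V_1$ on, some non-empty open subset of $M_1$. *The classes.* The Casalis class is the set of variance functions of the form $V(m)=a\,mm^T+m_1B_1+\cdots+m_nB_n+C$ with $a\in\mathbb R$ and $B_1,\dots,B_n,C$ symmetric matrices. The simple cubic (Morris–Mora) class is its image under all $T_g$, $g\in G$, that is, the union of the $G$-orbits of the elements of the Casalis class. *The types.* Consider - $V_{I,k}(m)=\mathrm{diag}(m_1,\dots,m_k,1,\dots,1)$ on $(0,\infty)^k\times\mathbb R^{n-k}$, for $0\le k\le n$ (Poisson–Gaussian; Gaussian for $k=0$); - $V_{II}(m)=-mm^T+\mathrm{diag}(m_1,\dots,m_n)$ on $\{m: m_i>0 \text{ for all } i,\ m_1+\cdots+m_n<1\}$ (multinomial); - $V_{III}(m)=mm^T+\mathrm{diag}(m_1,\dots,m_n)$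 on $(0,\infty)^n$ (negative multinomial); - $V_{IV,k}(m)=mm^T+\mathrm{diag}(0,m_2,\dots,m_k,m_1,\dots,m_1)$ on $(0,\infty)^k\times\mathbb R^{n-k}$, for $1\le k\le n$ (negative multinomial–gamma); - $V_{V}(m)=mm^T+\mathrm{diag}(m_1,\dots,m_{n-1},1+m_1+\cdots+m_{n-1})$ on $(0,\infty)^{n-1}\times\mathbb R$ (hyperbolic). All these functions belong to the Casalis class, and hence their $G$-orbits are contained in the simple cubic class. Moreover: 1. for every $k=1,\dots,n$, $V_{IV,k}$ belongs to the $G$-orbit of $V_{I,k}$, and $V_{I,k}$ and $V_{IV,k}$ have the same $G$-orbit; 2. $V_{III}$ belongs to the $G$-orbit of $V_{II}$, and $V_{II}$ and $V_{III}$ have the same $G$-orbit; 3. the $n+3$ $G$-orbits of $V_{I,0},V_{I,1},\dots,V_{I,n},V_{II},V_{V}$ are pairwise disjoint. -/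

import Mathlib

open MeasureTheory ProbabilityTheory Matrix
open scoped Matrix

noncomputable section

namespace SimpleCubic

/-! Vectors of `ℝⁿ` are elements of `Fin n → ℝ`, with scalar product `θ ⬝ᵥ x`; only the topology,
the Borel sets and differentiability matter below, so the choice of the norm is irrelevant. -/

/-! ### Natural exponential families -/

/-- `D(μ)`: the set of `θ` where the Laplace transform `∫ e^{⟨θ,x⟩} μ(dx)` is finite. -/
def laplaceDomain {n : ℕ} (μ : Measure (Fin n → ℝ)) : Set (Fin n → ℝ) :=
  {θ | Integrable (fun x => Real.exp (θ ⬝ᵥ x)) μ}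

/-- `Θ(μ)`: the interior of `D(μ)`. -/
def naturalDomain {n : ℕ} (μ : Measure (Fin n → ℝ)) : Set (Fin n → ℝ) :=
  interior (laplaceDomain μ)

/-- `μ ∈ 𝓜(ℝⁿ)`: `Θ(μ)` is not empty and `μ` is not concentrated on an affine hyperplane.
The measure `μ` may be unbounded. -/
structure IsGenerating {n : ℕ} (μ : Measure (Fin n → ℝ)) : Prop where
  nonempty : (naturalDomain μ).Nonempty
  not_hyperplane : ∀ (a : Fin n → ℝ) (r : ℝ), a ≠ 0 → ¬ ∀ᵐ x ∂μ, a ⬝ᵥ x = r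

/-- The member `P(θ,μ)(dx) = e^{⟨θ,x⟩ - k_μ(θ)} μ(dx)` of the family generated by `μ`. -/
def nef {n : ℕ} (μ : Measure (Fin n → ℝ)) (θ : Fin n → ℝ) : Measure (Fin n → ℝ) :=
  μ.tilted (fun x => θ ⬝ᵥ x)

/-- The mean of `P(θ,μ)`. -/
def nefMean {n : ℕ} (μ : Measure (Fin n → ℝ)) (θ : Fin n → ℝ) : Fin n → ℝ :=
  fun i => ∫ x, x i ∂(nef μ θ)

/-- The covariance matrix of `P(θ,μ)`. -/
def nefCov {n : ℕ} (μ : Measure (Fin n → ℝ)) (θ : Fin n → ℝ) : Matrix (Fin n) (Fin n) ℝ :=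
  Matrix.of fun i j => covariance (fun x => x i) (fun x => x j) (nef μ θ)

/-- The domain of the means of the family generated by `μ`. -/
def meanDomain {n : ℕ} (μ : Measure (Fin n → ℝ)) : Set (Fin n → ℝ) :=
  nefMean μ '' naturalDomain μ

/-- A matrix valued function `V` together with its domain `M ⊆ ℝⁿ`. The values of `val` outside
`dom` carry no meaning; no notion below depends on them. -/
structure MatrixFunction (n : ℕ) where
  dom : Set (Fin n → ℝ)
  val : (Fin n → ℝ) → Matrix (Fin n) (Fin n) ℝ

/-- `(V, M)` is the variance function of a natural exponential family: for some `μ ∈ 𝓜(ℝⁿ)`, `M` is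
the domain of the means of `F(μ)` and `V(m)` is the covariance matrix of the member of mean `m`. -/
def IsVarianceFunction {n : ℕ} (V : MatrixFunction n) : Prop :=
  ∃ μ : Measure (Fin n → ℝ), IsGenerating μ ∧ V.dom = meanDomain μ ∧
    ∀ θ ∈ naturalDomain μ, V.val (nefMean μ θ) = nefCov μ θ

/-! ### The action of `G = GL(n+1, ℝ)` -/

/-- `G = GL(n+1, ℝ)`, with rows and columns split in blocks of sizes `n` and `1`. -/
abbrev G (n : ℕ) : Type := Matrix.GeneralLinearGroup (Fin n ⊕ Unit) ℝ

/-- The block `A` of `g = [A b; cᵀ d]`. -/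
def blockA {n : ℕ} (g : G n) : Matrix (Fin n) (Fin n) ℝ := (g : Matrix (Fin n ⊕ Unit) (Fin n ⊕ Unit) ℝ).toBlocks₁₁

/-- The block `b` of `g = [A b; cᵀ d]`. -/
def blockB {n : ℕ} (g : G n) : Fin n → ℝ :=
  fun i => (g : Matrix (Fin n ⊕ Unit) (Fin n ⊕ Unit) ℝ) (Sum.inl i) (Sum.inr ())

/-- The block `c` of `g = [A b; cᵀ d]`. -/
def blockC {n : ℕ} (g : G n) : Fin n → ℝ :=
  fun j => (g : Matrix (Fin n ⊕ Unit) (Fin n ⊕ Unit) ℝ) (Sum.inr ()) (Sum.inl j)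

/-- The block `d` of `g = [A b; cᵀ d]`. -/
def blockD {n : ℕ} (g : G n) : ℝ :=
  (g : Matrix (Fin n ⊕ Unit) (Fin n ⊕ Unit) ℝ) (Sum.inr ()) (Sum.inr ())

/-- `cᵀm + d`. -/
def denom {n : ℕ} (g : G n) (m : Fin n → ℝ) : ℝ := blockC g ⬝ᵥ m + blockD g

/-- The homography `h_g(m) = (Am + b)/(cᵀm + d)`. -/
def homography {n : ℕ} (g : G n) (m : Fin n → ℝ) : Fin n → ℝ :=
  (denom g m)⁻¹ • (blockA g *ᵥ m + blockB g)

/-- The Jacobian matrix `h'_g(m)`. -/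
def homographyDeriv {n : ℕ} (g : G n) (m : Fin n → ℝ) : Matrix (Fin n) (Fin n) ℝ :=
  LinearMap.toMatrix' (fderiv ℝ (homography g) m : (Fin n → ℝ) →ₗ[ℝ] (Fin n → ℝ))

/-- `T_g(V)(m) = (cᵀm + d)⁻¹ h'_g(m)⁻¹ V(h_g(m)) (h'_g(m)ᵀ)⁻¹`; it is used only where
`cᵀm + d > 0` and `h_g(m)` is in the domain of `V`. -/
def T {n : ℕ} (g : G n) (V : MatrixFunction n) (m : Fin n → ℝ) : Matrix (Fin n) (Fin n) ℝ :=
  (denom g m)⁻¹ •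
    ((homographyDeriv g m)⁻¹ * V.val (homography g m) * ((homographyDeriv g m)ᵀ)⁻¹)

/-- The set `U_g` of the `m` with `cᵀm + d > 0` and `h_g(m) ∈ U`. -/
def pullback {n : ℕ} (g : G n) (U : Set (Fin n → ℝ)) : Set (Fin n → ℝ) :=
  {m | 0 < denom g m ∧ homography g m ∈ U}

/-- The `G`-orbit of `V`: all variance functions `V₁` such that, for some `g ∈ G`, `V₁ = T_g(V)` on
some non-empty open subset of the domain of `V₁` (on which `T_g(V)` is defined). -/
def GOrbit {n : ℕ} (V : MatrixFunction n) : Set (MatrixFunction n) :=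
  {V₁ | IsVarianceFunction V₁ ∧ ∃ (g : G n) (U : Set (Fin n → ℝ)),
    IsOpen U ∧ U.Nonempty ∧ U ⊆ V₁.dom ∧ U ⊆ pullback g V.dom ∧ ∀ m ∈ U, V₁.val m = T g V m}

/-- The Casalis class of simple quadratic variance functions: those of the form
`V(m) = a m mᵀ + m₁ B₁ + ⋯ + mₙ Bₙ + C` with `a` real and `B₁, …, Bₙ, C` symmetric. -/
def casalisClass (n : ℕ) : Set (MatrixFunction n) :=
  {V | IsVarianceFunction V ∧
    ∃ (a : ℝ) (B : Fin n → Matrix (Fin n) (Fin n) ℝ) (C : Matrix (Fin n) (Fin n) ℝ),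
      (∀ i, (B i).IsSymm) ∧ C.IsSymm ∧
      ∀ m ∈ V.dom, V.val m = a • vecMulVec m m + ∑ i, m i • B i + C}

/-- The Morris–Mora class of simple cubic variance functions: the image of the Casalis class
under the `T_g`, `g ∈ G`. -/
def morrisMoraClass (n : ℕ) : Set (MatrixFunction n) :=
  {V₁ | ∃ V ∈ casalisClass n, V₁ ∈ GOrbit V}

/-! ### The Casalis types

The coordinates `m₁, …, mₙ` are `m 0, …, m (n-1)`. -/

/-- Poisson–Gaussian: `diag(m₁,…,m_k,1,…,1)` on `(0,∞)^k × ℝ^{n-k}`; Gaussian for `k = 0`. -/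
def VI (n k : ℕ) : MatrixFunction n where
  dom := {m | ∀ i : Fin n, (i : ℕ) < k → 0 < m i}
  val m := diagonal fun i : Fin n => if (i : ℕ) < k then m i else 1

/-- Multinomial: `-m mᵀ + diag(m₁,…,mₙ)` on the interior of the convex hull of
`0, e₁, …, eₙ`. -/
def VII (n : ℕ) : MatrixFunction n where
  dom := {m | (∀ i, 0 < m i) ∧ ∑ i, m i < 1}
  val m := -vecMulVec m m + diagonal m

/-- Negative multinomial: `m mᵀ + diag(m₁,…,mₙ)` on `(0,∞)ⁿ`. -/
def VIII (n : ℕ) : MatrixFunction n where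
  dom := {m | ∀ i, 0 < m i}
  val m := vecMulVec m m + diagonal m

/-- Negative multinomial–gamma: `m mᵀ + diag(0,m₂,…,m_k,m₁,…,m₁)` on `(0,∞)^k × ℝ^{n-k}`. -/
def VIV (n : ℕ) [NeZero n] (k : ℕ) : MatrixFunction n where
  dom := {m | ∀ i : Fin n, (i : ℕ) < k → 0 < m i}
  val m := vecMulVec m m +
    diagonal fun i : Fin n => if i = 0 then 0 else if (i : ℕ) < k then m i else m 0

/-- Hyperbolic: `m mᵀ + diag(m₁,…,m_{n-1}, 1 + m₁ + ⋯ + m_{n-1})` on `(0,∞)^{n-1} × ℝ`. -/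
def VV (n : ℕ) : MatrixFunction n where
  dom := {m | ∀ i : Fin n, (i : ℕ) + 1 < n → 0 < m i}
  val m := vecMulVec m m +
    diagonal fun i : Fin n => if (i : ℕ) + 1 < n then m i
      else 1 + ∑ j : Fin n, if (j : ℕ) + 1 < n then m j else 0

end SimpleCubic

end

noncomputable section

namespace SimpleCubic

open Filter Topology

variable {n : ℕ}

/-! ### Moments of the members of a natural exponential family -/

/-! Each type is realised by an explicit measure whose cumulant transform has the shape `φ (∑ i, f i
(θ i))`. Its gradient is `φ' f'`, and its Hessian is a rank-one matrix plus a diagonal one, which is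
the form of all the types (`isVarianceFunction_of_laplace`). For I the measure is an exponential
series of convolutions, for II a finite sum of point masses, and for III, IV and V a geometric
series with Laplace transform `1 / (a - s)`.

The action becomes transparent in homogeneous coordinates. Write `V(m) = [I, -m] L(m, 1) [I, -m]ᵀ`
with `L` a linear pencil of matrices of order `n + 1`. Then `T_g` amounts to replacing `L(M)` by
`g⁻¹ L(g M) g⁻ᵀ`, because the Jacobians and the powers of `cᵀm + d` cancel (`T_eq_cubic`). The
coincidences of orbits are two such substitutions: exchanging the coordinates `1` and `n + 1` turns
I into IV, and adding `m₁ + ⋯ + mₙ` to the last coordinate turns II into III.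

For disjointness, suppose that `V₁` lies in two orbits. Each membership gives a cubic expression for
`V₁`, but a priori only on its own open set. Means and covariances are analytic along segments of
the convex set `Θ(μ)`, so each expression holds on the whole domain (`eq_cubic_of_eq_on_open`). The
two pencils then have the same cubic on an open set, so their difference `D` satisfies `ξᵀ D(M) ξ =
c(ξ) ξ(M)` (`isScalar_of_cubic_eq_zero`).

Two invariants survive both the action of `G` and the addition of such a `D`: the dimension of the
span of the forms `ξ` with `ξᵀ L(M) ξ` proportional to `ξ(M)`, and the existence of a degenerate
such form. The dimension is `k + 1` for `V_{I,k}`, `n + 1` for `V_{II}` and `n` for `V_V`.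
Degeneracy holds for every `V_{I,k}` and fails for `V_{II}` and `V_V`, which separates the cases of
equal dimension. -/

lemma measurable_dotProduct (u : Fin n → ℝ) : Measurable fun x : Fin n → ℝ => u ⬝ᵥ x := by
  unfold dotProduct; fun_prop

lemma isOpen_naturalDomain (μ : Measure (Fin n → ℝ)) : IsOpen (naturalDomain μ) := isOpen_interior

lemma integrable_of_mem_naturalDomain {μ : Measure (Fin n → ℝ)} {θ : Fin n → ℝ}
    (hθ : θ ∈ naturalDomain μ) : Integrable (fun x => Real.exp (θ ⬝ᵥ x)) μ :=
  interior_subset (s := laplaceDomain μ) hθ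

lemma eventually_mem_of_isOpen {O : Set (Fin n → ℝ)} (hO : IsOpen O) {θ : Fin n → ℝ} (hθ : θ ∈ O)
    (u : Fin n → ℝ) : ∀ᶠ t : ℝ in 𝓝 0, θ + t • u ∈ O := by
  have hc : Continuous fun t : ℝ => θ + t • u := by fun_prop
  apply hc.continuousAt.eventually_mem
  simpa using hO.mem_nhds hθ

/-- Tilting by `θ` shifts the Laplace domain by `-θ`, and `θ` is an interior point. This makes the
one-variable theory of moment generating functions available in every direction `u`. -/
lemma zero_mem_interior_integrableExpSet_nef {μ : Measure (Fin n → ℝ)} {θ : Fin n → ℝ}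
    (hθ : θ ∈ naturalDomain μ) (u : Fin n → ℝ) :
    (0 : ℝ) ∈ interior (integrableExpSet (fun x => u ⬝ᵥ x) (nef μ θ)) := by
  rw [mem_interior_iff_mem_nhds]
  filter_upwards [eventually_mem_of_isOpen (isOpen_naturalDomain μ) hθ u] with t ht
  simp only [integrableExpSet, Set.mem_ofPred_eq, nef]
  rw [integrable_tilted_iff (integrable_of_mem_naturalDomain hθ)]
  convert integrable_of_mem_naturalDomain ht using 2 with x
  rw [smul_eq_mul, ← Real.exp_add, add_dotProduct, smul_dotProduct, smul_eq_mul]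

lemma memLp_dotProduct_nef {μ : Measure (Fin n → ℝ)} {θ : Fin n → ℝ}
    (hθ : θ ∈ naturalDomain μ) (u : Fin n → ℝ) : MemLp (fun x => u ⬝ᵥ x) 2 (nef μ θ) :=
  memLp_of_mem_interior_integrableExpSet (zero_mem_interior_integrableExpSet_nef hθ u) 2

lemma memLp_coord_nef {μ : Measure (Fin n → ℝ)} {θ : Fin n → ℝ}
    (hθ : θ ∈ naturalDomain μ) (i : Fin n) : MemLp (fun x => x i) 2 (nef μ θ) := by
  simpa using memLp_dotProduct_nef hθ (Pi.single i 1)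

lemma isProbabilityMeasure_nef {μ : Measure (Fin n → ℝ)} [NeZero μ] {θ : Fin n → ℝ}
    (hθ : θ ∈ naturalDomain μ) : IsProbabilityMeasure (nef μ θ) :=
  isProbabilityMeasure_tilted (integrable_of_mem_naturalDomain hθ)

lemma dotProduct_nefMean {μ : Measure (Fin n → ℝ)} [NeZero μ] {θ : Fin n → ℝ}
    (hθ : θ ∈ naturalDomain μ) (u : Fin n → ℝ) :
    u ⬝ᵥ nefMean μ θ = ∫ x, u ⬝ᵥ x ∂(nef μ θ) := by
  have := isProbabilityMeasure_nef hθ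
  simp only [dotProduct, nefMean]
  rw [integral_finsetSum _ fun i _ =>
    ((memLp_coord_nef hθ i).integrable (by norm_num)).const_mul _]
  simp_rw [integral_const_mul]

lemma dotProduct_nefCov {μ : Measure (Fin n → ℝ)} [NeZero μ] {θ : Fin n → ℝ}
    (hθ : θ ∈ naturalDomain μ) (u : Fin n → ℝ) :
    u ⬝ᵥ nefCov μ θ *ᵥ u = Var[fun x => u ⬝ᵥ x; nef μ θ] := by
  have := isProbabilityMeasure_nef hθ
  rw [← covariance_self (measurable_dotProduct u).aemeasurable]
  simp only [dotProduct]
  rw [covariance_fun_sum_fun_sum (fun i => (memLp_coord_nef hθ i).const_mul _)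
    (fun i => (memLp_coord_nef hθ i).const_mul _)]
  simp only [mulVec, dotProduct, nefCov, of_apply, Finset.mul_sum]
  refine Finset.sum_congr rfl fun i _ => Finset.sum_congr rfl fun j _ => ?_
  rw [covariance_const_mul_left, covariance_const_mul_right]
  ring

lemma nefCov_isSymm (μ : Measure (Fin n → ℝ)) (θ : Fin n → ℝ) : (nefCov μ θ).IsSymm := by
  ext i j
  simp [nefCov, covariance_comm]

/-- Polarisation. It reduces covariance matrices to variances of linear forms, hence to cumulant
generating functions of one variable. -/
lemma eq_of_forall_quadratic {A B : Matrix (Fin n) (Fin n) ℝ} (hA : A.IsSymm) (hB : B.IsSymm)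
    (h : ∀ u : Fin n → ℝ, u ⬝ᵥ A *ᵥ u = u ⬝ᵥ B *ᵥ u) : A = B := by
  ext i j
  have h1 := h (Pi.single i 1 + Pi.single j 1)
  have h2 := h (Pi.single i 1)
  have h3 := h (Pi.single j 1)
  have h4 := hA.apply i j
  have h5 := hB.apply i j
  simp only [mulVec_add, add_dotProduct, dotProduct_add, mulVec_single_one, single_one_dotProduct,
    col_apply] at h1 h2 h3
  linarith

lemma cgf_nef {μ : Measure (Fin n → ℝ)} {K : (Fin n → ℝ) → ℝ}
    (hK : ∀ θ ∈ naturalDomain μ, ∫ x, Real.exp (θ ⬝ᵥ x) ∂μ = Real.exp (K θ)) {θ : Fin n → ℝ}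
    (hθ : θ ∈ naturalDomain μ) (u : Fin n → ℝ) {t : ℝ} (ht : θ + t • u ∈ naturalDomain μ) :
    cgf (fun x => u ⬝ᵥ x) (nef μ θ) t = K (θ + t • u) - K θ := by
  rw [cgf, mgf, nef, integral_exp_tilted]
  have : ∀ x : Fin n → ℝ, ((fun x => θ ⬝ᵥ x) + fun x => t * u ⬝ᵥ x) x = (θ + t • u) ⬝ᵥ x := by
    intro x; simp [add_dotProduct, smul_dotProduct]
  simp_rw [this]
  rw [hK θ hθ, hK _ ht, ← Real.exp_sub, Real.log_exp]

/-- If `exp ∘ K` is the Laplace transform of `μ`, the means and the covariances of the family of `μ`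
are the first and second derivatives of `K`. -/
lemma nefMean_nefCov_of_cumulant {μ : Measure (Fin n → ℝ)} {K : (Fin n → ℝ) → ℝ}
    {g : (Fin n → ℝ) → Fin n → ℝ} {W : (Fin n → ℝ) → Matrix (Fin n) (Fin n) ℝ}
    (hK : ∀ θ ∈ naturalDomain μ, ∫ x, Real.exp (θ ⬝ᵥ x) ∂μ = Real.exp (K θ))
    (hg : ∀ θ ∈ naturalDomain μ, ∀ u, HasDerivAt (fun t : ℝ => K (θ + t • u)) (u ⬝ᵥ g θ) 0)
    (hW : ∀ θ ∈ naturalDomain μ, ∀ u,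
      HasDerivAt (fun t : ℝ => u ⬝ᵥ g (θ + t • u)) (u ⬝ᵥ W θ *ᵥ u) 0)
    (hsymm : ∀ θ ∈ naturalDomain μ, (W θ).IsSymm) {θ : Fin n → ℝ} (hθ : θ ∈ naturalDomain μ) :
    nefMean μ θ = g θ ∧ nefCov μ θ = W θ := by
  have : NeZero μ := ⟨by
    rintro rfl
    have := hK θ hθ
    simp only [integral_zero_measure] at this
    exact (Real.exp_pos _).ne this⟩
  have hprob := isProbabilityMeasure_nef hθ
  have hev := eventually_mem_of_isOpen (isOpen_naturalDomain μ) hθ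
  have hcgf : ∀ u, cgf (fun x => u ⬝ᵥ x) (nef μ θ) =ᶠ[𝓝 0] fun t => K (θ + t • u) - K θ := by
    intro u
    filter_upwards [hev u] with t ht using cgf_nef hK hθ u ht
  -- The hypothesis `hg` only gives derivatives at parameter `0`; the derivative at `t` is obtained
  -- by moving the base point to `θ + t • u`.
  have hshift : ∀ (u : Fin n → ℝ) (t : ℝ), θ + t • u ∈ naturalDomain μ →
      HasDerivAt (fun s : ℝ => K (θ + s • u) - K θ) (u ⬝ᵥ g (θ + t • u)) t := by
    intro u t ht
    have h1 := hg _ ht u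
    have h2 : HasDerivAt (fun s : ℝ => s - t) 1 t := (hasDerivAt_id t).sub_const t
    have h3 := (HasDerivAt.comp_of_eq t h1 h2 (sub_self t).symm).sub_const (K θ)
    refine (h3.congr_deriv (mul_one _)).congr_of_eventuallyEq (Eventually.of_forall fun s => ?_)
    simp only [Function.comp_apply, sub_smul]
    congr 2
    abel
  have hderiv : ∀ u, deriv (cgf (fun x => u ⬝ᵥ x) (nef μ θ)) =ᶠ[𝓝 0]
      fun t => u ⬝ᵥ g (θ + t • u) := by
    intro u
    filter_upwards [hev u, (hcgf u).eventuallyEq_nhds] with t ht ht'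
    rw [ht'.deriv_eq, (hshift u t ht).deriv]
  constructor
  · have : ∀ u, u ⬝ᵥ nefMean μ θ = u ⬝ᵥ g θ := by
      intro u
      rw [dotProduct_nefMean hθ]
      have h1 := deriv_cgf_zero (zero_mem_interior_integrableExpSet_nef hθ u)
      have h2 := (hderiv u).eq_of_nhds
      simp only [zero_smul, add_zero] at h2
      rw [← h2, h1]
      simp
    ext i
    simpa using this (Pi.single i 1)
  · refine eq_of_forall_quadratic (nefCov_isSymm μ θ) (hsymm θ hθ) fun u => ?_
    rw [dotProduct_nefCov hθ]
    -- At parameter `0` the additional tilt is trivial, so the variance is the second derivative of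
    -- the cumulant generating function at `0`.
    have h1 := variance_tilted_mul (zero_mem_interior_integrableExpSet_nef hθ u)
    simp only [zero_mul, tilted_const] at h1
    rw [h1, iteratedDeriv_succ, iteratedDeriv_one, (hderiv u).deriv_eq, (hW θ hθ u).deriv]

/-- The Laplace transform of `μ`, with values in `[0, ∞]`. -/
def laplace (μ : Measure (Fin n → ℝ)) (θ : Fin n → ℝ) : ENNReal :=
  ∫⁻ x, ENNReal.ofReal (Real.exp (θ ⬝ᵥ x)) ∂μ

lemma measurable_exp_dotProduct (θ : Fin n → ℝ) :
    Measurable fun x : Fin n → ℝ => Real.exp (θ ⬝ᵥ x) :=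
  Real.measurable_exp.comp (measurable_dotProduct θ)

lemma mem_laplaceDomain_iff {μ : Measure (Fin n → ℝ)} {θ : Fin n → ℝ} :
    θ ∈ laplaceDomain μ ↔ laplace μ θ < ⊤ := by
  rw [laplaceDomain, Set.mem_ofPred_eq, Integrable,
    and_iff_right (measurable_exp_dotProduct θ).aestronglyMeasurable,
    hasFiniteIntegral_iff_ofReal (Eventually.of_forall fun x => (Real.exp_pos _).le), laplace]

lemma integral_exp_eq_of_laplace {μ : Measure (Fin n → ℝ)} {θ : Fin n → ℝ} {r : ℝ} (hr : 0 ≤ r)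
    (h : laplace μ θ = ENNReal.ofReal r) : ∫ x, Real.exp (θ ⬝ᵥ x) ∂μ = r := by
  rw [integral_eq_lintegral_of_nonneg_ae (Eventually.of_forall fun x => (Real.exp_pos _).le)
    (measurable_exp_dotProduct θ).aestronglyMeasurable]
  change (laplace μ θ).toReal = r
  rw [h, ENNReal.toReal_ofReal hr]

lemma dotProduct_rank_one_add_diagonal (p q : ℝ) (a d u : Fin n → ℝ) :
    u ⬝ᵥ (p • vecMulVec a a + q • diagonal d) *ᵥ u = p * (u ⬝ᵥ a) ^ 2 + q * ∑ i, d i * u i ^ 2 := by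
  rw [add_mulVec, smul_mulVec, smul_mulVec, dotProduct_add, dotProduct_smul, dotProduct_smul,
    vecMulVec_mulVec, smul_eq_mul, smul_eq_mul]
  congr 2
  · rw [dotProduct_comm a u]
    simp [dotProduct, sq, Finset.sum_mul, mul_assoc]
  · simp only [dotProduct, mulVec_diagonal]
    exact Finset.sum_congr rfl fun i _ => by ring

/-- A criterion for being a variance function: the cumulant transform is `φ (∑ i, f i (θ i))`. -/
lemma isVarianceFunction_of_laplace {V : MatrixFunction n} (μ : Measure (Fin n → ℝ))
    {O : Set (Fin n → ℝ)} {φ φ' φ'' : ℝ → ℝ} {f f' f'' : Fin n → ℝ → ℝ}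
    (hO : IsOpen O)
    (hfin : ∀ θ ∈ O, laplace μ θ = ENNReal.ofReal (Real.exp (φ (∑ i, f i (θ i)))))
    (htop : ∀ θ, θ ∉ O → laplace μ θ = ⊤)
    (hf : ∀ i x, HasDerivAt (f i) (f' i x) x) (hf' : ∀ i x, HasDerivAt (f' i) (f'' i x) x)
    (hφ : ∀ θ ∈ O, HasDerivAt φ (φ' (∑ i, f i (θ i))) (∑ i, f i (θ i)))
    (hφ' : ∀ θ ∈ O, HasDerivAt φ' (φ'' (∑ i, f i (θ i))) (∑ i, f i (θ i)))
    (hmem : ∀ θ ∈ O, (fun i => φ' (∑ i, f i (θ i)) * f' i (θ i)) ∈ V.dom)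
    (hsurj : ∀ m ∈ V.dom, ∃ θ ∈ O, (fun i => φ' (∑ i, f i (θ i)) * f' i (θ i)) = m)
    (hval : ∀ θ ∈ O, V.val (fun i => φ' (∑ i, f i (θ i)) * f' i (θ i)) =
      φ'' (∑ i, f i (θ i)) • vecMulVec (fun i => f' i (θ i)) (fun i => f' i (θ i)) +
        φ' (∑ i, f i (θ i)) • diagonal fun i => f'' i (θ i))
    (hne : V.dom.Nonempty)
    (hpos : ∀ m ∈ V.dom, ∀ a : Fin n → ℝ, a ⬝ᵥ V.val m *ᵥ a = 0 → a = 0) :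
    IsVarianceFunction V := by
  -- The transform is finite exactly on the open set `O`, so taking the interior loses nothing.
  have hD : laplaceDomain μ = O := by
    ext θ
    rw [mem_laplaceDomain_iff]
    by_cases h : θ ∈ O
    · simp [h, hfin θ h]
    · simp [h, htop θ h]
  have hN : naturalDomain μ = O := by rw [naturalDomain, hD, hO.interior_eq]
  have hs : ∀ (θ u : Fin n → ℝ), HasDerivAt (fun t : ℝ => ∑ i, f i ((θ + t • u) i))
      (∑ i, u i * f' i (θ i)) 0 := by
    intro θ u
    refine HasDerivAt.fun_sum fun i _ => ?_
    have h1 : HasDerivAt (fun t : ℝ => θ i + t * u i) (u i) 0 := by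
      simpa using ((hasDerivAt_id (0 : ℝ)).mul_const (u i)).const_add (θ i)
    have h2 := hf i (θ i + 0 * u i)
    have h3 := HasDerivAt.comp (0 : ℝ) h2 h1
    simp only [zero_mul, add_zero] at h3
    rw [mul_comm]
    exact h3
  have hs' : ∀ (i : Fin n) (θ u : Fin n → ℝ), HasDerivAt (fun t : ℝ => f' i ((θ + t • u) i))
      (u i * f'' i (θ i)) 0 := by
    intro i θ u
    have h1 : HasDerivAt (fun t : ℝ => θ i + t * u i) (u i) 0 := by
      simpa using ((hasDerivAt_id (0 : ℝ)).mul_const (u i)).const_add (θ i)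
    have h2 := hf' i (θ i + 0 * u i)
    have h3 := HasDerivAt.comp (0 : ℝ) h2 h1
    simp only [zero_mul, add_zero] at h3
    rw [mul_comm]
    exact h3
  have key : ∀ θ ∈ naturalDomain μ, nefMean μ θ = (fun i => φ' (∑ i, f i (θ i)) * f' i (θ i)) ∧
      nefCov μ θ = φ'' (∑ i, f i (θ i)) • vecMulVec (fun i => f' i (θ i)) (fun i => f' i (θ i)) +
        φ' (∑ i, f i (θ i)) • diagonal fun i => f'' i (θ i) := by
    intro θ hθ
    refine nefMean_nefCov_of_cumulant (K := fun θ => φ (∑ i, f i (θ i)))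
      (g := fun θ i => φ' (∑ i, f i (θ i)) * f' i (θ i))
      (W := fun θ => φ'' (∑ i, f i (θ i)) • vecMulVec (fun i => f' i (θ i)) (fun i => f' i (θ i)) +
        φ' (∑ i, f i (θ i)) • diagonal fun i => f'' i (θ i)) ?_ ?_ ?_ ?_ hθ
    · intro θ hθ
      exact integral_exp_eq_of_laplace (Real.exp_pos _).le (hfin θ (hN ▸ hθ))
    · intro θ hθ u
      have h1 := hφ θ (hN ▸ hθ)
      have h2 : HasDerivAt φ (φ' (∑ i, f i (θ i))) (∑ i, f i ((θ + (0 : ℝ) • u) i)) := by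
        simpa using h1
      have h3 := HasDerivAt.comp (0 : ℝ) h2 (hs θ u)
      refine h3.congr_deriv ?_
      simp only [dotProduct, Finset.mul_sum]
      exact Finset.sum_congr rfl fun i _ => by ring
    · intro θ hθ u
      have h1 := hφ' θ (hN ▸ hθ)
      have h2 : HasDerivAt φ' (φ'' (∑ i, f i (θ i))) (∑ i, f i ((θ + (0 : ℝ) • u) i)) := by
        simpa using h1
      have h3 := HasDerivAt.comp (0 : ℝ) h2 (hs θ u)
      have h4 : HasDerivAt (fun t : ℝ => ∑ i, u i * (φ' (∑ i, f i ((θ + t • u) i)) *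
          f' i ((θ + t • u) i))) (∑ i, u i * (φ'' (∑ i, f i (θ i)) * (∑ i, u i * f' i (θ i)) *
            f' i (θ i) + φ' (∑ i, f i (θ i)) * (u i * f'' i (θ i)))) 0 := by
        refine HasDerivAt.fun_sum fun i _ => HasDerivAt.const_mul _ ?_
        simpa [Function.comp_def, Pi.mul_def] using h3.mul (hs' i θ u)
      refine h4.congr_deriv ?_
      rw [dotProduct_rank_one_add_diagonal, sq, dotProduct]
      simp only [mul_add, Finset.sum_add_distrib]
      have hc : ∀ c, ∑ i, u i * (c * f' i (θ i)) = c * ∑ i, u i * f' i (θ i) := by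
        intro c
        rw [Finset.mul_sum]
        exact Finset.sum_congr rfl fun i _ => by ring
      congr 1
      · rw [hc, mul_assoc]
      · rw [Finset.mul_sum]
        exact Finset.sum_congr rfl fun i _ => by ring
    · intro θ _
      ext i j
      simp only [transpose_apply, Matrix.add_apply, Matrix.smul_apply, vecMulVec_apply,
        diagonal_apply, smul_eq_mul, mul_comm (f' i _), eq_comm (a := j)]
      split_ifs with h <;> simp [h]
  have hdom : V.dom = meanDomain μ := by
    ext m
    constructor
    · intro hm
      obtain ⟨θ, hθ, rfl⟩ := hsurj m hm
      exact ⟨θ, hN ▸ hθ, (key θ (hN ▸ hθ)).1⟩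
    · rintro ⟨θ, hθ, rfl⟩
      rw [(key θ hθ).1]
      exact hmem θ (hN ▸ hθ)
  have hcov : ∀ θ ∈ naturalDomain μ, V.val (nefMean μ θ) = nefCov μ θ := by
    intro θ hθ
    rw [(key θ hθ).1, (key θ hθ).2]
    exact hval θ (hN ▸ hθ)
  refine ⟨μ, ⟨?_, ?_⟩, hdom, hcov⟩
  · obtain ⟨m, hm⟩ := hne
    obtain ⟨θ, hθ, -⟩ := hsurj m hm
    exact ⟨θ, hN ▸ hθ⟩
  -- If `μ` lived on a hyperplane `a ⬝ᵥ x = r`, the variance of `a ⬝ᵥ x` under a member of the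
  -- family would vanish, against `hpos`.
  · intro a r ha hae
    obtain ⟨m, hm⟩ := hne
    have hm' := hm
    rw [hdom] at hm'
    obtain ⟨θ, hθ, rfl⟩ := hm'
    have : NeZero μ := ⟨by
      rintro rfl
      have := hfin θ (hN ▸ hθ)
      simp only [laplace, lintegral_zero_measure] at this
      exact absurd this.symm (by simp [Real.exp_pos])⟩
    have := isProbabilityMeasure_nef hθ
    refine ha (hpos _ hm a ?_)
    rw [hcov θ hθ, dotProduct_nefCov hθ]
    have hae' : (fun x => a ⬝ᵥ x) =ᵐ[nef μ θ] fun _ => r :=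
      (tilted_absolutelyContinuous μ _).ae_le hae
    rw [variance_congr hae', variance_eq_integral aemeasurable_const]
    simp

/-! ### Laplace transforms -/

lemma measurable_ofReal_exp (θ : Fin n → ℝ) :
    Measurable fun x : Fin n → ℝ => ENNReal.ofReal (Real.exp (θ ⬝ᵥ x)) :=
  (measurable_exp_dotProduct θ).ennreal_ofReal

lemma laplace_dirac (a θ : Fin n → ℝ) :
    laplace (Measure.dirac a) θ = ENNReal.ofReal (Real.exp (θ ⬝ᵥ a)) :=
  lintegral_dirac' a (measurable_ofReal_exp θ)

lemma laplace_add (μ ν : Measure (Fin n → ℝ)) (θ : Fin n → ℝ) :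
    laplace (μ + ν) θ = laplace μ θ + laplace ν θ :=
  lintegral_add_measure _ _ _

lemma laplace_smul (c : ENNReal) (μ : Measure (Fin n → ℝ)) (θ : Fin n → ℝ) :
    laplace (c • μ) θ = c * laplace μ θ := by
  rw [laplace, lintegral_smul_measure, smul_eq_mul, laplace]

lemma laplace_sum (μ : ℕ → Measure (Fin n → ℝ)) (θ : Fin n → ℝ) :
    laplace (Measure.sum μ) θ = ∑' j, laplace (μ j) θ :=
  lintegral_sum_measure _ _

lemma laplace_conv (μ ν : Measure (Fin n → ℝ)) [SFinite ν] (θ : Fin n → ℝ) :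
    laplace (μ.conv ν) θ = laplace μ θ * laplace ν θ := by
  rw [laplace, Measure.lintegral_conv (measurable_ofReal_exp θ)]
  simp_rw [dotProduct_add, Real.exp_add, ENNReal.ofReal_mul (Real.exp_pos _).le]
  simp_rw [lintegral_const_mul _ (measurable_ofReal_exp θ)]
  rw [lintegral_mul_const _ (measurable_ofReal_exp θ)]
  rfl

/-- `ρ ∗ ν ∗ ⋯ ∗ ν`, with `j` factors `ν`. -/
def convPow (ρ ν : Measure (Fin n → ℝ)) : ℕ → Measure (Fin n → ℝ)
  | 0 => ρ
  | j + 1 => (convPow ρ ν j).conv ν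

lemma laplace_convPow (ρ ν : Measure (Fin n → ℝ)) [SFinite ν] (θ : Fin n → ℝ) (j : ℕ) :
    laplace (convPow ρ ν j) θ = laplace ρ θ * laplace ν θ ^ j := by
  induction j with
  | zero => simp [convPow]
  | succ j ih => rw [convPow, laplace_conv, ih, pow_succ, mul_assoc]

/-- `∑ j, ρ ∗ ν ^ {∗ j} / j!`. -/
def expMeasure (ρ ν : Measure (Fin n → ℝ)) : Measure (Fin n → ℝ) :=
  Measure.sum fun j => ENNReal.ofReal ((j.factorial : ℝ)⁻¹) • convPow ρ ν j

/-- `∑ j, ρ ∗ (ν ∗ ρ) ^ {∗ j}`. -/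
def geomMeasure (ρ ν : Measure (Fin n → ℝ)) : Measure (Fin n → ℝ) :=
  Measure.sum fun j => convPow ρ (ν.conv ρ) j

/-- Convolution powers turn into powers of `s`, and the sum is the exponential series. In type I,
`ρ` is the Gaussian factor and `ν` produces the Poisson coordinates. -/
lemma laplace_expMeasure {ρ ν : Measure (Fin n → ℝ)} [SFinite ν] {θ : Fin n → ℝ} {r s : ℝ}
    (hr : laplace ρ θ = ENNReal.ofReal (Real.exp r)) (hs0 : 0 ≤ s)
    (hs : laplace ν θ = ENNReal.ofReal s) :
    laplace (expMeasure ρ ν) θ = ENNReal.ofReal (Real.exp (r + s)) := by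
  rw [expMeasure, laplace_sum]
  have : ∀ j : ℕ, laplace (ENNReal.ofReal ((j.factorial : ℝ)⁻¹) • convPow ρ ν j) θ =
      ENNReal.ofReal (Real.exp r) * ENNReal.ofReal (s ^ j / j.factorial) := by
    intro j
    rw [laplace_smul, laplace_convPow, hr, hs, div_eq_inv_mul,
      ENNReal.ofReal_mul (by positivity), ← ENNReal.ofReal_pow hs0]
    ring
  simp_rw [this]
  rw [ENNReal.tsum_mul_left, ← ENNReal.ofReal_tsum_of_nonneg (fun j => by positivity)
    (Real.summable_pow_div_factorial s), ← ENNReal.ofReal_mul (Real.exp_pos _).le, Real.exp_add,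
    Real.exp_eq_exp_ℝ, NormedSpace.exp_eq_tsum_div]

/-- Geometric series in `[0, ∞]`. With truncated subtraction and `0⁻¹ = ⊤` the formula also covers
divergence, so it decides exactly where the transform is finite. -/
lemma laplace_geomMeasure (ρ ν : Measure (Fin n → ℝ)) [SFinite ν] [SFinite ρ] (θ : Fin n → ℝ) :
    laplace (geomMeasure ρ ν) θ = laplace ρ θ * (1 - laplace ν θ * laplace ρ θ)⁻¹ := by
  rw [geomMeasure, laplace_sum]
  simp_rw [laplace_convPow, laplace_conv]
  rw [ENNReal.tsum_mul_left, ENNReal.tsum_geometric]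

/-- Including `ρ` in each convolution factor gives `a⁻¹ / (1 - s a⁻¹) = 1 / (a - s)`: the
exponentials in `s` are subtracted from the denominator `a` of the transform of `ρ`. -/
lemma laplace_geomMeasure_of_lt {ρ ν : Measure (Fin n → ℝ)} [SFinite ν] [SFinite ρ]
    {θ : Fin n → ℝ} {a s : ℝ} (ha : 0 < a) (hs0 : 0 ≤ s)
    (hρ : laplace ρ θ = ENNReal.ofReal a⁻¹) (hν : laplace ν θ = ENNReal.ofReal s) (h : s < a) :
    laplace (geomMeasure ρ ν) θ = ENNReal.ofReal (a - s)⁻¹ := by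
  have h1 : 0 < a - s := by linarith
  have h2 : (1 : ℝ) - s * a⁻¹ = (a - s) / a := by field_simp
  rw [laplace_geomMeasure, hρ, hν, ← ENNReal.ofReal_mul hs0, ← ENNReal.ofReal_one,
    ← ENNReal.ofReal_sub _ (by positivity), h2, ← ENNReal.ofReal_inv_of_pos (by positivity),
    ← ENNReal.ofReal_mul (by positivity)]
  congr 1
  field_simp

lemma laplace_geomMeasure_of_le {ρ ν : Measure (Fin n → ℝ)} [SFinite ν] [SFinite ρ]
    {θ : Fin n → ℝ} {a s : ℝ} (ha : 0 < a) (hs0 : 0 ≤ s)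
    (hρ : laplace ρ θ = ENNReal.ofReal a⁻¹) (hν : laplace ν θ = ENNReal.ofReal s) (h : a ≤ s) :
    laplace (geomMeasure ρ ν) θ = ⊤ := by
  have h1 : (1 : ENNReal) - ENNReal.ofReal s * ENNReal.ofReal a⁻¹ = 0 := by
    rw [tsub_eq_zero_iff_le, ← ENNReal.ofReal_mul hs0, ← ENNReal.ofReal_one]
    apply ENNReal.ofReal_le_ofReal
    rw [← div_eq_mul_inv, le_div_iff₀ ha]
    linarith
  rw [laplace_geomMeasure, hρ, hν, h1, ENNReal.inv_zero, ENNReal.mul_top]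
  simpa using ha

lemma laplace_geomMeasure_of_top {ρ ν : Measure (Fin n → ℝ)} [SFinite ν] [SFinite ρ]
    {θ : Fin n → ℝ} (hρ : laplace ρ θ = ⊤) : laplace (geomMeasure ρ ν) θ = ⊤ := by
  rw [laplace_geomMeasure, hρ, ENNReal.top_mul]
  rw [ENNReal.inv_ne_zero]
  exact (tsub_le_self.trans_lt ENNReal.one_lt_top).ne

/-- The sum of the unit masses at the `eᵢ`, `i ∈ A`. -/
def unitMasses (A : Finset (Fin n)) : Measure (Fin n → ℝ) :=
  ∑ i ∈ A, Measure.dirac (Pi.single i 1)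

instance (A : Finset (Fin n)) : IsFiniteMeasure (unitMasses A) := by
  unfold unitMasses; infer_instance

lemma laplace_unitMasses (A : Finset (Fin n)) (θ : Fin n → ℝ) :
    laplace (unitMasses A) θ = ENNReal.ofReal (∑ i ∈ A, Real.exp (θ i)) := by
  rw [laplace, unitMasses, lintegral_finsetSum_measure,
    ENNReal.ofReal_sum_of_nonneg fun i _ => (Real.exp_pos _).le]
  refine Finset.sum_congr rfl fun i _ => ?_
  have := laplace_dirac (Pi.single i 1) θ
  rw [laplace] at this
  rw [this]
  simp

/-- The standard Gaussian law in the coordinates `k, k+1, …`, the others being `0`. -/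
def tailGaussian (n k : ℕ) : Measure (Fin n → ℝ) :=
  Measure.pi fun i : Fin n => if (i : ℕ) < k then Measure.dirac 0 else gaussianReal 0 1

instance (k : ℕ) (i : Fin n) :
    IsProbabilityMeasure (if (i : ℕ) < k then Measure.dirac (0 : ℝ) else gaussianReal 0 1) := by
  split_ifs <;> infer_instance

instance (k : ℕ) : IsProbabilityMeasure (tailGaussian n k) := by
  unfold tailGaussian; infer_instance

lemma laplace_tailGaussian (k : ℕ) (θ : Fin n → ℝ) :
    laplace (tailGaussian n k) θ =
      ENNReal.ofReal (Real.exp (∑ i : Fin n, if (i : ℕ) < k then 0 else θ i ^ 2 / 2)) := by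
  have h1 : ∀ x : Fin n → ℝ, Real.exp (θ ⬝ᵥ x) = ∏ i, Real.exp (θ i * x i) := fun x => by
    rw [dotProduct, Real.exp_sum]
  rw [laplace]
  simp_rw [h1, tailGaussian]
  rw [← ofReal_integral_eq_lintegral_ofReal _
    (Eventually.of_forall fun x => Finset.prod_nonneg fun i _ => (Real.exp_pos _).le)]
  · rw [integral_fintype_prod_eq_prod (f := fun i x => Real.exp (θ i * x)), Real.exp_sum]
    congr 1
    refine Finset.prod_congr rfl fun i _ => ?_
    split_ifs with h
    · simp
    · have := congrFun (mgf_id_gaussianReal (μ := 0) (v := 1)) (θ i)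
      simpa [mgf] using this
  · refine Integrable.fintype_prod_dep (f := fun i x => Real.exp (θ i * x)) fun i => ?_
    split_ifs with h
    · exact integrable_dirac (by simp)
    · exact integrable_exp_mul_gaussianReal _

/-- The law of `(s, √s z)`, `s` having the Lebesgue measure on `(0, ∞)` and `z` the standard
Gaussian law in the coordinates `k, k+1, …`. -/
def gammaGaussian (n : ℕ) [NeZero n] (k : ℕ) : Measure (Fin n → ℝ) :=
  ((volume.restrict (Set.Ioi (0 : ℝ))).prod (tailGaussian n k)).map
    fun p => p.1 • Pi.single (0 : Fin n) (1 : ℝ) + Real.sqrt p.1 • p.2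

instance [NeZero n] (k : ℕ) : SFinite (gammaGaussian n k) := by
  unfold gammaGaussian; infer_instance

/-- For fixed `s`, integrating over `z` gives the Gaussian transform at `√s θ`, whose exponent is
`s` times the one at `θ`. A single exponential in `s` remains. -/
lemma laplace_gammaGaussian_eq [NeZero n] (k : ℕ) (θ : Fin n → ℝ) :
    laplace (gammaGaussian n k) θ = ∫⁻ s in Set.Ioi (0 : ℝ), ENNReal.ofReal
      (Real.exp ((θ 0 + ∑ i : Fin n, if (i : ℕ) < k then 0 else θ i ^ 2 / 2) * s)) := by
  have hm : Measurable fun p : ℝ × (Fin n → ℝ) =>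
      p.1 • Pi.single (0 : Fin n) (1 : ℝ) + Real.sqrt p.1 • p.2 := by fun_prop
  have hg : Measurable fun p : ℝ × (Fin n → ℝ) => ENNReal.ofReal (Real.exp
      (θ ⬝ᵥ (p.1 • Pi.single (0 : Fin n) (1 : ℝ) + Real.sqrt p.1 • p.2))) :=
    (measurable_ofReal_exp θ).comp hm
  rw [laplace, gammaGaussian, lintegral_map (measurable_ofReal_exp θ) hm,
    lintegral_prod _ hg.aemeasurable]
  refine setLIntegral_congr_fun measurableSet_Ioi fun s hs => ?_
  have hs' : (0 : ℝ) ≤ s := le_of_lt hs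
  have h1 : ∀ z : Fin n → ℝ, θ ⬝ᵥ (s • Pi.single (0 : Fin n) (1 : ℝ) + Real.sqrt s • z) =
      θ 0 * s + (Real.sqrt s • θ) ⬝ᵥ z := by
    intro z
    rw [dotProduct_add, dotProduct_smul, dotProduct_smul, smul_dotProduct, dotProduct_single_one,
      smul_eq_mul, mul_comm]
  simp_rw [h1, Real.exp_add, ENNReal.ofReal_mul (Real.exp_pos _).le]
  rw [lintegral_const_mul _ (measurable_ofReal_exp _)]
  have h2 := laplace_tailGaussian k (Real.sqrt s • θ)
  rw [laplace] at h2
  rw [h2, ← ENNReal.ofReal_mul (Real.exp_pos _).le, ← Real.exp_add, add_mul, Finset.sum_mul]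
  congr 3
  refine Finset.sum_congr rfl fun i _ => ?_
  split_ifs
  · simp
  · rw [Pi.smul_apply, smul_eq_mul, mul_pow, Real.sq_sqrt hs']
    ring

lemma lintegral_exp_mul_Ioi_of_neg {a : ℝ} (ha : a < 0) :
    ∫⁻ s in Set.Ioi (0 : ℝ), ENNReal.ofReal (Real.exp (a * s)) = ENNReal.ofReal (-a)⁻¹ := by
  rw [← ofReal_integral_eq_lintegral_ofReal (integrableOn_exp_mul_Ioi ha 0)
    (Eventually.of_forall fun x => (Real.exp_pos _).le), integral_exp_mul_Ioi ha]
  rw [mul_zero, Real.exp_zero, inv_neg, neg_div, one_div]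

lemma lintegral_exp_mul_Ioi_of_nonneg {a : ℝ} (ha : 0 ≤ a) :
    ∫⁻ s in Set.Ioi (0 : ℝ), ENNReal.ofReal (Real.exp (a * s)) = ⊤ := by
  rw [eq_top_iff]
  calc (⊤ : ENNReal) = ∫⁻ _ in Set.Ioi (0 : ℝ), 1 := by simp
    _ ≤ _ := by
      refine setLIntegral_mono' measurableSet_Ioi fun s hs => ?_
      rw [← ENNReal.ofReal_one]
      exact ENNReal.ofReal_le_ofReal (Real.one_le_exp (mul_nonneg ha (le_of_lt hs)))

/-- The measure `x ^ (-1/2) e⁻ˣ dx` on `(0, ∞)`. -/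
def halfGamma : Measure ℝ :=
  (volume.restrict (Set.Ioi (0 : ℝ))).withDensity
    fun x => ENNReal.ofReal (x ^ (-(1 / 2) : ℝ) * Real.exp (-x))

instance : SFinite halfGamma := by unfold halfGamma; infer_instance

lemma lintegral_halfGamma (t : ℝ) :
    ∫⁻ x, ENNReal.ofReal (Real.exp (t * Real.log x)) ∂halfGamma =
      ∫⁻ x in Set.Ioi (0 : ℝ), ENNReal.ofReal (Real.exp (-x) * x ^ ((1 / 2 + t) - 1)) := by
  rw [halfGamma, lintegral_withDensity_eq_lintegral_mul _ (by fun_prop) (by fun_prop)]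
  refine setLIntegral_congr_fun measurableSet_Ioi fun x hx => ?_
  have hx' : 0 < x := hx
  simp only [Pi.mul_apply]
  rw [← ENNReal.ofReal_mul (by positivity), mul_comm t, ← Real.rpow_def_of_pos hx', mul_right_comm,
    ← Real.rpow_add hx', mul_comm]
  congr 3
  ring

lemma lintegral_halfGamma_of_lt {t : ℝ} (ht : -(1 / 2) < t) :
    ∫⁻ x, ENNReal.ofReal (Real.exp (t * Real.log x)) ∂halfGamma =
      ENNReal.ofReal (Real.Gamma (1 / 2 + t)) := by
  have h : 0 < 1 / 2 + t := by linarith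
  rw [lintegral_halfGamma, ← ofReal_integral_eq_lintegral_ofReal (Real.GammaIntegral_convergent h),
    Real.Gamma_eq_integral h]
  filter_upwards [ae_restrict_mem measurableSet_Ioi] with x hx
  have hx' : 0 < x := hx
  change 0 ≤ Real.exp (-x) * x ^ ((1 / 2 + t) - 1)
  positivity

/-- The divergence is at `0`: on `(0, 1)` the factor `e⁻ˣ` is at least `e⁻¹`, so finiteness would
make a power of exponent at most `-1` integrable there. -/
lemma lintegral_halfGamma_of_le {t : ℝ} (ht : t ≤ -(1 / 2)) :
    ∫⁻ x, ENNReal.ofReal (Real.exp (t * Real.log x)) ∂halfGamma = ⊤ := by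
  rw [lintegral_halfGamma]
  by_contra hfin
  have h1 : ¬ IntegrableOn (fun x : ℝ => x ^ ((1 / 2 + t) - 1)) (Set.Ioo (0 : ℝ) 1) := by
    rw [intervalIntegral.integrableOn_Ioo_rpow_iff one_pos]
    linarith
  apply h1
  have hint : IntegrableOn (fun x => Real.exp (-x) * x ^ ((1 / 2 + t) - 1)) (Set.Ioi (0 : ℝ)) := by
    refine ⟨by fun_prop, ?_⟩
    rw [hasFiniteIntegral_iff_ofReal]
    · exact lt_top_iff_ne_top.mpr hfin
    filter_upwards [ae_restrict_mem measurableSet_Ioi] with x hx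
    have hx' : 0 < x := hx
    change 0 ≤ Real.exp (-x) * x ^ ((1 / 2 + t) - 1)
    positivity
  have hint' := (hint.mono_set (fun x (hx : x ∈ Set.Ioo (0 : ℝ) 1) => hx.1)).const_mul (Real.exp 1)
  refine Integrable.mono' hint' (by fun_prop) ?_
  filter_upwards [ae_restrict_mem measurableSet_Ioo] with x hx
  have hx' : 0 < x := hx.1
  rw [Real.norm_of_nonneg (by positivity), ← mul_assoc, ← Real.exp_add]
  exact le_mul_of_one_le_left (by positivity) (Real.one_le_exp (by linarith [hx.2]))

/-- A measure carried by the axis `ℓ`, with Laplace transform `1 / cos (θ ℓ)`. -/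
def secantMeasure (ℓ : Fin n) : Measure (Fin n → ℝ) :=
  ENNReal.ofReal Real.pi⁻¹ • (halfGamma.prod halfGamma).map
    fun p => (Real.pi⁻¹ * (Real.log p.1 - Real.log p.2)) • Pi.single ℓ (1 : ℝ)

instance (ℓ : Fin n) : SFinite (secantMeasure ℓ) := by
  unfold secantMeasure; infer_instance

lemma laplace_secantMeasure_eq (ℓ : Fin n) (θ : Fin n → ℝ) :
    laplace (secantMeasure ℓ) θ = ENNReal.ofReal Real.pi⁻¹ *
      ((∫⁻ x, ENNReal.ofReal (Real.exp (θ ℓ / Real.pi * Real.log x)) ∂halfGamma) *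
        ∫⁻ x, ENNReal.ofReal (Real.exp (-(θ ℓ / Real.pi) * Real.log x)) ∂halfGamma) := by
  have hm : Measurable fun p : ℝ × ℝ =>
      (Real.pi⁻¹ * (Real.log p.1 - Real.log p.2)) • Pi.single ℓ (1 : ℝ) := by
    refine Measurable.smul_const ?_ _
    fun_prop
  rw [secantMeasure, laplace_smul, laplace, lintegral_map (measurable_ofReal_exp θ) hm,
    ← lintegral_prod_mul (by fun_prop) (by fun_prop)]
  congr 1
  refine lintegral_congr fun p => ?_
  rw [← ENNReal.ofReal_mul (Real.exp_pos _).le, ← Real.exp_add, dotProduct_smul,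
    dotProduct_single_one, smul_eq_mul]
  congr 2
  ring

/-- Euler's reflection formula at `z = 1/2 + θ_ℓ / π`: `Γ(z) Γ(1 - z) = π / sin(π z) = π / cos θ_ℓ`.
-/
lemma laplace_secantMeasure_of_lt (ℓ : Fin n) {θ : Fin n → ℝ} (h1 : -(Real.pi / 2) < θ ℓ)
    (h2 : θ ℓ < Real.pi / 2) :
    laplace (secantMeasure ℓ) θ = ENNReal.ofReal (Real.cos (θ ℓ))⁻¹ := by
  have hπ := Real.pi_pos
  have h3 : θ ℓ / Real.pi < 1 / 2 := by rw [div_lt_iff₀ hπ]; linarith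
  have h4 : -(1 / 2) < θ ℓ / Real.pi := by rw [lt_div_iff₀ hπ]; linarith
  have h5 := Real.Gamma_mul_Gamma_one_sub (1 / 2 + θ ℓ / Real.pi)
  have h6 : Real.sin (Real.pi * (1 / 2 + θ ℓ / Real.pi)) = Real.cos (θ ℓ) := by
    rw [← Real.sin_pi_div_two_sub, ← Real.sin_pi_sub]
    congr 1
    field_simp
    ring
  rw [h6, show 1 - (1 / 2 + θ ℓ / Real.pi) = 1 / 2 + -(θ ℓ / Real.pi) by ring] at h5
  rw [laplace_secantMeasure_eq, lintegral_halfGamma_of_lt h4,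
    lintegral_halfGamma_of_lt (by linarith), ← ENNReal.ofReal_mul
      (Real.Gamma_nonneg_of_nonneg (by linarith)), h5, ← ENNReal.ofReal_mul (by positivity)]
  congr 1
  field_simp

/-- Outside the strip exactly one of the two factors diverges. The other is a strictly positive
Gamma value, which excludes the product `0 * ⊤`. -/
lemma laplace_secantMeasure_of_not (ℓ : Fin n) {θ : Fin n → ℝ}
    (h : ¬ (-(Real.pi / 2) < θ ℓ ∧ θ ℓ < Real.pi / 2)) :
    laplace (secantMeasure ℓ) θ = ⊤ := by
  have hπ := Real.pi_pos
  have hpos : ∀ t : ℝ, -(1 / 2) < t → ENNReal.ofReal (Real.Gamma (1 / 2 + t)) ≠ 0 := by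
    intro t ht
    simpa using Real.Gamma_pos_of_pos (by linarith)
  rw [laplace_secantMeasure_eq, ENNReal.mul_eq_top]
  left
  refine ⟨by simpa using hπ, ?_⟩
  rw [ENNReal.mul_eq_top]
  by_cases h1 : -(Real.pi / 2) < θ ℓ
  · have h2 : 1 / 2 ≤ θ ℓ / Real.pi := by
      rw [le_div_iff₀ hπ]
      have := not_lt.mp fun h2 => h ⟨h1, h2⟩
      linarith
    left
    refine ⟨?_, lintegral_halfGamma_of_le (by linarith)⟩
    rw [lintegral_halfGamma_of_lt (by linarith)]
    exact hpos _ (by linarith)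
  · have h2 : θ ℓ / Real.pi ≤ -(1 / 2) := by
      rw [div_le_iff₀ hπ]
      linarith
    right
    refine ⟨lintegral_halfGamma_of_le h2, ?_⟩
    rw [lintegral_halfGamma_of_lt (by linarith)]
    exact hpos _ (by linarith)

/-! ### The types are variance functions -/

/-- The criterion `isVarianceFunction_of_laplace` for Laplace transforms `1 / (c - ∑ i, f i (θ i))`. -/
lemma isVarianceFunction_of_inv {V : MatrixFunction n} (μ : Measure (Fin n → ℝ))
    {O : Set (Fin n → ℝ)} {f f' f'' : Fin n → ℝ → ℝ} (c : ℝ) (d : (Fin n → ℝ) → Fin n → ℝ)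
    (hO : IsOpen O) (hlt : ∀ θ ∈ O, ∑ i, f i (θ i) < c)
    (hfin : ∀ θ ∈ O, laplace μ θ = ENNReal.ofReal (c - ∑ i, f i (θ i))⁻¹)
    (htop : ∀ θ, θ ∉ O → laplace μ θ = ⊤)
    (hf : ∀ i x, HasDerivAt (f i) (f' i x) x) (hf' : ∀ i x, HasDerivAt (f' i) (f'' i x) x)
    (hmem : ∀ θ ∈ O, (fun i => (c - ∑ i, f i (θ i))⁻¹ * f' i (θ i)) ∈ V.dom)
    (hsurj : ∀ m ∈ V.dom, ∃ θ ∈ O, (fun i => (c - ∑ i, f i (θ i))⁻¹ * f' i (θ i)) = m)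
    (hval : ∀ m, V.val m = vecMulVec m m + diagonal (d m))
    (hd : ∀ θ ∈ O, ∀ i, d (fun i => (c - ∑ i, f i (θ i))⁻¹ * f' i (θ i)) i =
      (c - ∑ i, f i (θ i))⁻¹ * f'' i (θ i))
    (hne : V.dom.Nonempty)
    (hpos : ∀ m ∈ V.dom, ∀ a : Fin n → ℝ, (a ⬝ᵥ m) ^ 2 + ∑ i, d m i * a i ^ 2 = 0 → a = 0) :
    IsVarianceFunction V := by
  -- For this `φ` one has `φ'' = (φ')²`, so the rank-one part of the Hessian is exactly `m mᵀ`.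
  refine isVarianceFunction_of_laplace μ (φ := fun s => -Real.log (c - s))
    (φ' := fun s => (c - s)⁻¹) (φ'' := fun s => ((c - s)⁻¹) ^ 2) hO ?_ htop hf hf' ?_ ?_ hmem hsurj
    ?_ hne ?_
  · intro θ hθ
    rw [hfin θ hθ, Real.exp_neg, Real.exp_log (by linarith [hlt θ hθ])]
  · intro θ hθ
    have h : c - ∑ i, f i (θ i) ≠ 0 := by linarith [hlt θ hθ]
    have h1 := (((hasDerivAt_id (∑ i, f i (θ i))).const_sub c).log h).neg
    refine h1.congr_deriv ?_
    simp [neg_div]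
  · intro θ hθ
    have h : c - ∑ i, f i (θ i) ≠ 0 := by linarith [hlt θ hθ]
    have h1 := ((hasDerivAt_id (∑ i, f i (θ i))).const_sub c).fun_inv h
    refine h1.congr_deriv ?_
    simp
  · intro θ hθ
    rw [hval]
    ext i j
    simp only [Matrix.add_apply, Matrix.smul_apply, vecMulVec_apply, smul_eq_mul, diagonal_apply]
    congr 1
    · ring
    · split_ifs
      · exact hd θ hθ i
      · simp
  · intro m hm a ha
    refine hpos m hm a ?_
    have := dotProduct_rank_one_add_diagonal 1 1 m (d m) a
    rw [one_smul, one_smul, ← hval, ha] at this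
    linarith

lemma mem_casalisClass_of_diagonal {V : MatrixFunction n} (hV : IsVarianceFunction V) (a : ℝ)
    (β : Fin n → Fin n → ℝ) (γ : Fin n → ℝ)
    (h : ∀ m ∈ V.dom, V.val m = a • vecMulVec m m + diagonal fun i => ∑ j, m j * β j i + γ i) :
    V ∈ casalisClass n := by
  refine ⟨hV, a, fun j => diagonal (β j), diagonal γ, fun i => isSymm_diagonal _,
    isSymm_diagonal _, fun m hm => ?_⟩
  rw [h m hm, add_assoc]
  congr 1
  ext i j
  simp only [diagonal_apply, Matrix.add_apply, Matrix.sum_apply, Matrix.smul_apply, smul_eq_mul]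
  split_ifs <;> simp

lemma eq_zero_of_sum_mul_sq {d a : Fin n → ℝ} (hd : ∀ i, 0 < d i) (h : ∑ i, d i * a i ^ 2 = 0) :
    a = 0 := by
  rw [Finset.sum_eq_zero_iff_of_nonneg fun i _ => mul_nonneg (hd i).le (sq_nonneg _)] at h
  ext i
  have := h i (Finset.mem_univ i)
  simpa [(hd i).ne'] using this

lemma isVarianceFunction_VI (n k : ℕ) : IsVarianceFunction (VI n k) := by
  refine isVarianceFunction_of_laplace
    (expMeasure (tailGaussian n k) (unitMasses (Finset.univ.filter fun i : Fin n => (i : ℕ) < k)))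
    (O := Set.univ) (φ := fun s => s) (φ' := fun _ => 1) (φ'' := fun _ => 0)
    (f := fun i x => if (i : ℕ) < k then Real.exp x else x ^ 2 / 2)
    (f' := fun i x => if (i : ℕ) < k then Real.exp x else x)
    (f'' := fun i x => if (i : ℕ) < k then Real.exp x else 1) isOpen_univ ?_ ?_ ?_ ?_ ?_ ?_ ?_ ?_ ?_
    ?_ ?_
  · intro θ _
    rw [laplace_expMeasure (laplace_tailGaussian k θ)
      (Finset.sum_nonneg fun i _ => (Real.exp_pos _).le) (laplace_unitMasses _ θ),
      Finset.sum_filter, ← Finset.sum_add_distrib]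
    congr 2
    refine Finset.sum_congr rfl fun i _ => ?_
    split_ifs <;> simp
  · intro θ h
    simp at h
  · intro i x
    by_cases h : (i : ℕ) < k
    · simp only [h, if_true]
      exact Real.hasDerivAt_exp x
    · simp only [h, if_false]
      exact ((hasDerivAt_pow 2 x).div_const 2).congr_deriv (by simp)
  · intro i x
    by_cases h : (i : ℕ) < k
    · simp only [h, if_true]
      exact Real.hasDerivAt_exp x
    · simp only [h, if_false]
      exact hasDerivAt_id x
  · intro θ _
    exact hasDerivAt_id _
  · intro θ _
    exact hasDerivAt_const _ _
  · intro θ _ i hi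
    simp [hi, Real.exp_pos]
  · intro m hm
    refine ⟨fun i => if (i : ℕ) < k then Real.log (m i) else m i, trivial, ?_⟩
    ext i
    by_cases h : (i : ℕ) < k
    · simp [h, Real.exp_log (hm i h)]
    · simp [h]
  · intro θ _
    simp only [VI, zero_smul, one_smul, zero_add, one_mul]
    congr 1
    ext i
    split_ifs <;> rfl
  · exact ⟨fun _ => 1, fun i _ => one_pos⟩
  · intro m hm a ha
    refine eq_zero_of_sum_mul_sq (d := fun i : Fin n => if (i : ℕ) < k then m i else 1) ?_ ?_
    · intro i
      by_cases h : (i : ℕ) < k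
      · simpa [h] using hm i h
      · simp [h]
    · rw [← ha]
      simp only [VI, dotProduct, mulVec_diagonal]
      exact Finset.sum_congr rfl fun i _ => by ring

lemma VI_mem_casalisClass (n k : ℕ) : VI n k ∈ casalisClass n := by
  refine mem_casalisClass_of_diagonal (isVarianceFunction_VI n k) 0
    (fun j i => if i = j ∧ (i : ℕ) < k then 1 else 0) (fun i => if (i : ℕ) < k then 0 else 1) ?_
  intro m _
  simp only [VI, zero_smul, zero_add]
  congr 1
  ext i
  by_cases h : (i : ℕ) < k <;> simp [h]

lemma isVarianceFunction_VII (n : ℕ) : IsVarianceFunction (VII n) := by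
  have hS : ∀ θ : Fin n → ℝ, 0 < 1 + ∑ i, Real.exp (θ i) := fun θ => by
    have : 0 ≤ ∑ i, Real.exp (θ i) := Finset.sum_nonneg fun i _ => (Real.exp_pos _).le
    linarith
  refine isVarianceFunction_of_laplace (Measure.dirac 0 + unitMasses Finset.univ) (O := Set.univ)
    (φ := fun s => Real.log (1 + s)) (φ' := fun s => (1 + s)⁻¹)
    (φ'' := fun s => -((1 + s)⁻¹) ^ 2) (f := fun _ => Real.exp) (f' := fun _ => Real.exp)
    (f'' := fun _ => Real.exp) isOpen_univ ?_ ?_ (fun _ => Real.hasDerivAt_exp)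
    (fun _ => Real.hasDerivAt_exp) ?_ ?_ ?_ ?_ ?_ ?_ ?_
  · intro θ _
    rw [laplace_add, laplace_dirac, laplace_unitMasses, Real.exp_log (hS θ), dotProduct_zero,
      Real.exp_zero, ENNReal.ofReal_add zero_le_one
        (Finset.sum_nonneg fun i _ => (Real.exp_pos _).le)]
  · intro θ h
    simp at h
  · intro θ _
    exact (((hasDerivAt_id (∑ i, Real.exp (θ i))).const_add 1).log (hS θ).ne').congr_deriv
      (by simp)
  · intro θ _
    exact (((hasDerivAt_id (∑ i, Real.exp (θ i))).const_add 1).fun_inv (hS θ).ne').congr_deriv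
      (by simp [neg_div])
  · intro θ _
    refine ⟨fun i => mul_pos (inv_pos.mpr (hS θ)) (Real.exp_pos _), ?_⟩
    simp only
    rw [← Finset.mul_sum, ← div_eq_inv_mul, div_lt_one (hS θ)]
    linarith
  · rintro m ⟨hm, hm1⟩
    have h1 : 0 < 1 - ∑ i, m i := by linarith
    -- Solves `m i = exp (θ i) / (1 + S)` with `S = ∑ exp (θ i)`: summing over `i` gives `1 + S = 1
    -- / (1 - ∑ m i)`.
    refine ⟨fun i => Real.log (m i / (1 - ∑ i, m i)), trivial, ?_⟩
    have h2 : ∀ i, Real.exp (Real.log (m i / (1 - ∑ i, m i))) = m i / (1 - ∑ i, m i) :=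
      fun i => Real.exp_log (div_pos (hm i) h1)
    ext i
    simp only [h2]
    rw [← Finset.sum_div]
    have h3 : 1 + (∑ i, m i) / (1 - ∑ i, m i) = 1 / (1 - ∑ i, m i) := by
      field_simp
      ring
    rw [h3]
    field_simp
  · intro θ _
    simp only [VII]
    ext i j
    simp only [Matrix.add_apply, Matrix.neg_apply, Matrix.smul_apply, vecMulVec_apply, smul_eq_mul,
      diagonal_apply]
    split_ifs <;> ring
  · refine ⟨fun _ => (1 / (n + 1) : ℝ), fun i => by positivity, ?_⟩
    simp only [Finset.sum_const, Finset.card_univ, Fintype.card_fin, nsmul_eq_mul]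
    rw [mul_one_div, div_lt_one (by positivity)]
    linarith
  · rintro m ⟨hm, hm1⟩ a ha
    have h1 := dotProduct_rank_one_add_diagonal (-1) 1 m m a
    rw [neg_smul, one_smul, one_smul] at h1
    change a ⬝ᵥ (-vecMulVec m m + diagonal m) *ᵥ a = 0 at ha
    rw [ha] at h1
    -- Cauchy–Schwarz with weights `m i`. As `∑ m i < 1`, the term `-m mᵀ` cannot cancel the
    -- diagonal form.
    have h2 : (a ⬝ᵥ m) ^ 2 ≤ (∑ i, m i) * ∑ i, m i * a i ^ 2 := by
      refine Finset.sum_sq_le_sum_mul_sum_of_sq_le_mul _ (fun i _ => (hm i).le)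
        (fun i _ => mul_nonneg (hm i).le (sq_nonneg _)) fun i _ => le_of_eq ?_
      ring
    have h3 : 0 ≤ ∑ i, m i * a i ^ 2 :=
      Finset.sum_nonneg fun i _ => mul_nonneg (hm i).le (sq_nonneg _)
    refine eq_zero_of_sum_mul_sq hm ?_
    nlinarith

lemma VII_mem_casalisClass (n : ℕ) : VII n ∈ casalisClass n := by
  refine mem_casalisClass_of_diagonal (isVarianceFunction_VII n) (-1)
    (fun j i => if i = j then 1 else 0) 0 ?_
  intro m _
  simp only [VII, neg_smul, one_smul]
  congr 2
  ext i
  simp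

lemma isVarianceFunction_VIII (n : ℕ) : IsVarianceFunction (VIII n) := by
  have hs : ∀ θ : Fin n → ℝ, 0 ≤ ∑ i, Real.exp (θ i) := fun θ =>
    Finset.sum_nonneg fun i _ => (Real.exp_pos _).le
  have hρ : ∀ θ : Fin n → ℝ, laplace (Measure.dirac 0) θ = ENNReal.ofReal (1 : ℝ)⁻¹ := fun θ => by
    rw [laplace_dirac, dotProduct_zero, Real.exp_zero, inv_one]
  refine isVarianceFunction_of_inv (geomMeasure (Measure.dirac 0) (unitMasses Finset.univ))
    (O := {θ | ∑ i, Real.exp (θ i) < 1}) (f := fun _ => Real.exp) (f' := fun _ => Real.exp)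
    (f'' := fun _ => Real.exp) 1 (fun m => m) ?_ (fun θ h => h) ?_ ?_ (fun _ => Real.hasDerivAt_exp)
    (fun _ => Real.hasDerivAt_exp) ?_ ?_ (fun m => rfl) ?_ ?_ ?_
  · exact isOpen_lt (by fun_prop) continuous_const
  · intro θ h
    exact laplace_geomMeasure_of_lt one_pos (hs θ) (hρ θ) (laplace_unitMasses _ θ) h
  · intro θ h
    exact laplace_geomMeasure_of_le one_pos (hs θ) (hρ θ) (laplace_unitMasses _ θ) (not_lt.mp h)
  · intro θ h i
    have h' : ∑ i, Real.exp (θ i) < 1 := h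
    exact mul_pos (inv_pos.mpr (by linarith)) (Real.exp_pos _)
  · intro m hm
    have hsum : 0 ≤ ∑ i, m i := Finset.sum_nonneg fun i _ => (hm i).le
    have h1 : 0 < 1 + ∑ i, m i := by linarith
    have h2 : ∀ i, Real.exp (Real.log (m i / (1 + ∑ i, m i))) = m i / (1 + ∑ i, m i) :=
      fun i => Real.exp_log (div_pos (hm i) h1)
    -- Same inversion as for the multinomial type with the sign changed: here `1 - ∑ exp (θ i) = 1 /
    -- (1 + ∑ m i)`.
    refine ⟨fun i => Real.log (m i / (1 + ∑ i, m i)), ?_, ?_⟩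
    · simp only [Set.mem_ofPred_eq, h2]
      rw [← Finset.sum_div, div_lt_one h1]
      linarith
    · ext i
      simp only [h2]
      rw [← Finset.sum_div]
      have h3 : 1 - (∑ i, m i) / (1 + ∑ i, m i) = 1 / (1 + ∑ i, m i) := by
        field_simp
        ring
      rw [h3]
      field_simp
  · intro θ _ i
    rfl
  · exact ⟨fun _ => 1, fun _ => one_pos⟩
  · intro m hm a ha
    have h3 : 0 ≤ ∑ i, m i * a i ^ 2 :=
      Finset.sum_nonneg fun i _ => mul_nonneg (hm i).le (sq_nonneg _)
    exact eq_zero_of_sum_mul_sq hm (by nlinarith [sq_nonneg (a ⬝ᵥ m)])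

lemma VIII_mem_casalisClass (n : ℕ) : VIII n ∈ casalisClass n := by
  refine mem_casalisClass_of_diagonal (isVarianceFunction_VIII n) 1
    (fun j i => if i = j then 1 else 0) 0 ?_
  intro m _
  simp only [VIII, one_smul]
  congr 2
  ext i
  simp

/-- The Laplace transform is `1 / (-∑ f i (θ i))`, where coordinate `0` enters linearly (gamma), the
next ones by exponentials and the last ones by squares. -/
lemma isVarianceFunction_VIV (n : ℕ) [NeZero n] {k : ℕ} (hk : 1 ≤ k) :
    IsVarianceFunction (VIV n k) := by
  set A : Finset (Fin n) := Finset.univ.filter fun i : Fin n => i ≠ 0 ∧ (i : ℕ) < k with hA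
  set f : Fin n → ℝ → ℝ := fun i x =>
    if i = 0 then x else if (i : ℕ) < k then Real.exp x else x ^ 2 / 2 with hfdef
  set f' : Fin n → ℝ → ℝ := fun i x =>
    if i = 0 then 1 else if (i : ℕ) < k then Real.exp x else x with hf'def
  set f'' : Fin n → ℝ → ℝ := fun i x =>
    if i = 0 then 0 else if (i : ℕ) < k then Real.exp x else 1 with hf''def
  have h0k : ((0 : Fin n) : ℕ) < k := by simpa using Nat.lt_of_lt_of_le Nat.zero_lt_one hk
  have hsplit : ∀ θ : Fin n → ℝ, ∑ i, f i (θ i) =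
      (θ 0 + ∑ i : Fin n, if (i : ℕ) < k then 0 else θ i ^ 2 / 2) + ∑ i ∈ A, Real.exp (θ i) := by
    intro θ
    have : θ 0 = ∑ i, if i = 0 then θ i else 0 := by simp
    rw [this, hA, Finset.sum_filter, ← Finset.sum_add_distrib, ← Finset.sum_add_distrib]
    refine Finset.sum_congr rfl fun i _ => ?_
    by_cases hi : i = 0
    · subst hi
      simp [hfdef, Nat.pos_of_ne_zero (Nat.one_le_iff_ne_zero.mp hk)]
    · by_cases hik : (i : ℕ) < k <;> simp [hfdef, hi, hik]
  have hs : ∀ θ : Fin n → ℝ, 0 ≤ ∑ i ∈ A, Real.exp (θ i) := fun θ =>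
    Finset.sum_nonneg fun i _ => (Real.exp_pos _).le
  have hf : ∀ i x, HasDerivAt (f i) (f' i x) x := by
    intro i x
    by_cases hi : i = 0
    · simp only [hfdef, hf'def, hi, if_true]
      exact hasDerivAt_id x
    · by_cases h : (i : ℕ) < k
      · simp only [hfdef, hf'def, hi, h, if_true, if_false]
        exact Real.hasDerivAt_exp x
      · simp only [hfdef, hf'def, hi, h, if_false]
        exact ((hasDerivAt_pow 2 x).div_const 2).congr_deriv (by simp)
  have hcont : ∀ i, Continuous (f i) := fun i =>
    continuous_iff_continuousAt.mpr fun x => (hf i x).continuousAt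
  refine isVarianceFunction_of_inv (geomMeasure (gammaGaussian n k) (unitMasses A))
    (O := {θ | ∑ i, f i (θ i) < 0}) (f := f) (f' := f') (f'' := f'') 0
    (fun m i => if i = 0 then 0 else if (i : ℕ) < k then m i else m 0) ?_ (fun θ h => h) ?_ ?_ hf ?_
    ?_ ?_ (fun m => rfl) ?_ ?_ ?_
  · refine isOpen_lt (continuous_finsetSum _ fun i _ => ?_) continuous_const
    exact (hcont i).comp (continuous_apply i)
  · intro θ h
    rw [Set.mem_ofPred_eq, hsplit] at h
    have ha : θ 0 + (∑ i : Fin n, if (i : ℕ) < k then 0 else θ i ^ 2 / 2) < 0 := by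
      linarith [hs θ]
    rw [laplace_geomMeasure_of_lt (neg_pos.mpr ha) (hs θ) ?_ (laplace_unitMasses _ θ)
      (by linarith), hsplit]
    · congr 2
      ring
    · rw [laplace_gammaGaussian_eq, lintegral_exp_mul_Ioi_of_neg ha]
  · intro θ h
    rw [Set.mem_ofPred_eq, hsplit, not_lt] at h
    by_cases ha : θ 0 + (∑ i : Fin n, if (i : ℕ) < k then 0 else θ i ^ 2 / 2) < 0
    · refine laplace_geomMeasure_of_le (neg_pos.mpr ha) (hs θ) ?_ (laplace_unitMasses _ θ)
        (by linarith)
      rw [laplace_gammaGaussian_eq, lintegral_exp_mul_Ioi_of_neg ha]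
    · refine laplace_geomMeasure_of_top ?_
      rw [laplace_gammaGaussian_eq, lintegral_exp_mul_Ioi_of_nonneg (not_lt.mp ha)]
  · intro i x
    by_cases hi : i = 0
    · simp only [hf''def, hf'def, hi, if_true]
      exact hasDerivAt_const _ _
    · by_cases h : (i : ℕ) < k
      · simp only [hf''def, hf'def, hi, h, if_true, if_false]
        exact Real.hasDerivAt_exp x
      · simp only [hf''def, hf'def, hi, h, if_false]
        exact hasDerivAt_id x
  · intro θ h i hi
    have h' : ∑ i, f i (θ i) < 0 := h
    refine mul_pos (inv_pos.mpr (by linarith)) ?_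
    by_cases hi0 : i = 0
    · simp [hf'def, hi0]
    · simp [hf'def, hi0, hi, Real.exp_pos]
  · intro m hm
    have hm0 : 0 < m 0 := hm 0 h0k
    have hlog : ∀ i : Fin n, (i : ℕ) < k → Real.exp (Real.log (m i / m 0)) = m i / m 0 :=
      fun i hi => Real.exp_log (div_pos (hm i hi) hm0)
    -- Since `f' 0 = 1`, the mean `m 0` is the common factor `φ'`, and `f' i (θ i) = m i / m 0`
    -- fixes the other coordinates. The free linear coordinate `θ 0` is then chosen so that the
    -- total is `-1 / m 0`.
    set η : Fin n → ℝ := fun i => if (i : ℕ) < k then Real.log (m i / m 0) else m i / m 0 with hη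
    set r : ℝ := ∑ i, if i = 0 then 0 else f i (η i) with hr
    have hsum : ∑ i, f i (Function.update η 0 (-(m 0)⁻¹ - r) i) = -(m 0)⁻¹ := by
      rw [← Finset.add_sum_erase _ _ (Finset.mem_univ 0), Function.update_self]
      have : ∑ i ∈ Finset.univ.erase 0, f i (Function.update η 0 (-(m 0)⁻¹ - r) i) = r := by
        rw [hr, ← Finset.add_sum_erase _ _ (Finset.mem_univ (0 : Fin n)), if_pos rfl, zero_add]
        refine Finset.sum_congr rfl fun i hi => ?_
        have hi0 := (Finset.mem_erase.mp hi).1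
        rw [Function.update_of_ne hi0, if_neg hi0]
      rw [this]
      simp only [hfdef, if_true]
      ring
    refine ⟨Function.update η 0 (-(m 0)⁻¹ - r), ?_, ?_⟩
    · rw [Set.mem_ofPred_eq, hsum]
      have := inv_pos.mpr hm0
      linarith
    · ext i
      rw [hsum, zero_sub, neg_neg, inv_inv]
      by_cases hi : i = 0
      · simp [hf'def, hi]
      · rw [Function.update_of_ne hi]
        by_cases h : (i : ℕ) < k
        · simp only [hf'def, hη, hi, h, if_true, if_false, hlog i h]
          field_simp
        · simp only [hf'def, hη, hi, h, if_false]
          field_simp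
  · intro θ _ i
    by_cases hi : i = 0
    · simp [hf''def, hi]
    · by_cases h : (i : ℕ) < k <;> simp [hf''def, hf'def, hi, h]
  · exact ⟨fun _ => 1, fun _ _ => one_pos⟩
  · intro m hm a ha
    have hm0 : 0 < m 0 := hm 0 h0k
    have hd : ∀ i : Fin n, i ≠ 0 →
        0 < if i = 0 then (0 : ℝ) else if (i : ℕ) < k then m i else m 0 := by
      intro i hi
      by_cases h : (i : ℕ) < k
      · simpa [hi, h] using hm i h
      · simpa [hi, h] using hm0
    have hnn : ∀ i ∈ (Finset.univ : Finset (Fin n)),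
        0 ≤ (if i = 0 then 0 else if (i : ℕ) < k then m i else m 0) * a i ^ 2 := by
      intro i _
      by_cases hi : i = 0
      · simp [hi]
      · exact mul_nonneg (hd i hi).le (sq_nonneg _)
    have h3 := Finset.sum_nonneg hnn
    have h4 : (a ⬝ᵥ m) ^ 2 = 0 := by nlinarith [sq_nonneg (a ⬝ᵥ m)]
    have h5 := (Finset.sum_eq_zero_iff_of_nonneg hnn).mp
      (by nlinarith [sq_nonneg (a ⬝ᵥ m)])
    -- The diagonal part does not see coordinate `0`. Once the other coordinates vanish, the
    -- rank-one part gives `a 0 * m 0 = 0`.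
    have h6 : ∀ i, i ≠ 0 → a i = 0 := by
      intro i hi
      have := h5 i (Finset.mem_univ i)
      rw [mul_eq_zero, or_iff_right (hd i hi).ne'] at this
      simpa using this
    have h7 : a ⬝ᵥ m = a 0 * m 0 := by
      rw [dotProduct, Finset.sum_eq_single 0]
      · intro i _ hi
        rw [h6 i hi, zero_mul]
      · simp
    rw [h7] at h4
    ext i
    by_cases hi : i = 0
    · subst hi
      simpa [hm0.ne'] using h4
    · exact h6 i hi

lemma VIV_mem_casalisClass (n : ℕ) [NeZero n] {k : ℕ} (hk : 1 ≤ k) :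
    VIV n k ∈ casalisClass n := by
  refine mem_casalisClass_of_diagonal (isVarianceFunction_VIV n hk) 1
    (fun j i => if i = 0 then 0 else if (i : ℕ) < k then (if i = j then 1 else 0)
      else (if 0 = j then 1 else 0)) 0 ?_
  intro m _
  simp only [VIV, one_smul]
  congr 2
  ext i
  by_cases hi : i = 0
  · simp [hi]
  · by_cases h : (i : ℕ) < k <;> simp [hi, h]

/-- The Laplace transform is `1 / (cos θ_ℓ - ∑ exp (θ i))`, with `ℓ` the last coordinate and the sum
over the others, on the part of the strip `|θ_ℓ| < π / 2` where the denominator is positive. -/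
lemma isVarianceFunction_VV (n : ℕ) [NeZero n] : IsVarianceFunction (VV n) := by
  have hn : 0 < n := Nat.pos_of_ne_zero (NeZero.ne n)
  set A : Finset (Fin n) := Finset.univ.filter fun i : Fin n => (i : ℕ) + 1 < n with hA
  set ℓ : Fin n := ⟨n - 1, by omega⟩ with hℓ
  have hlast : ∀ i : Fin n, ¬ (i : ℕ) + 1 < n ↔ i = ℓ := by
    intro i
    rw [Fin.ext_iff]
    simp only [hℓ]
    omega
  have hℓA : ¬ ((ℓ : Fin n) : ℕ) + 1 < n := (hlast ℓ).mpr rfl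
  set f : Fin n → ℝ → ℝ := fun i x =>
    if (i : ℕ) + 1 < n then Real.exp x else -Real.cos x with hfdef
  set f' : Fin n → ℝ → ℝ := fun i x =>
    if (i : ℕ) + 1 < n then Real.exp x else Real.sin x with hf'def
  set f'' : Fin n → ℝ → ℝ := fun i x =>
    if (i : ℕ) + 1 < n then Real.exp x else Real.cos x with hf''def
  have hsplit : ∀ θ : Fin n → ℝ, ∑ i, f i (θ i) = (∑ i ∈ A, Real.exp (θ i)) - Real.cos (θ ℓ) := by
    intro θ
    have : -Real.cos (θ ℓ) = ∑ i, if i = ℓ then -Real.cos (θ i) else 0 := by simp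
    rw [sub_eq_add_neg, this, hA, Finset.sum_filter, ← Finset.sum_add_distrib]
    refine Finset.sum_congr rfl fun i _ => ?_
    by_cases h : (i : ℕ) + 1 < n
    · have h' : i ≠ ℓ := fun h' => (hlast i).mpr h' h
      simp [hfdef, h, h']
    · simp [hfdef, (hlast i).mp h, hℓA]
  have hs : ∀ θ : Fin n → ℝ, 0 ≤ ∑ i ∈ A, Real.exp (θ i) := fun θ =>
    Finset.sum_nonneg fun i _ => (Real.exp_pos _).le
  have hf : ∀ i x, HasDerivAt (f i) (f' i x) x := by
    intro i x
    by_cases h : (i : ℕ) + 1 < n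
    · simp only [hfdef, hf'def, h, if_true]
      exact Real.hasDerivAt_exp x
    · simp only [hfdef, hf'def, h, if_false]
      exact (Real.hasDerivAt_cos x).neg.congr_deriv (by simp)
  have hsumA : ∀ m : Fin n → ℝ, (∑ j : Fin n, if (j : ℕ) + 1 < n then m j else 0) = ∑ j ∈ A, m j :=
    fun m => by rw [hA, Finset.sum_filter]
  refine isVarianceFunction_of_inv (geomMeasure (secantMeasure ℓ) (unitMasses A))
    (O := {θ | (-(Real.pi / 2) < θ ℓ ∧ θ ℓ < Real.pi / 2) ∧
      ∑ i ∈ A, Real.exp (θ i) < Real.cos (θ ℓ)}) (f := f) (f' := f') (f'' := f'') 0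
    (fun m i => if (i : ℕ) + 1 < n then m i
      else 1 + ∑ j : Fin n, if (j : ℕ) + 1 < n then m j else 0) ?_ ?_ ?_ ?_ hf ?_
    ?_ ?_ (fun m => rfl) ?_ ?_ ?_
  · have h1 : IsOpen {θ : Fin n → ℝ | -(Real.pi / 2) < θ ℓ} :=
      isOpen_lt (by fun_prop) (by fun_prop)
    have h2 : IsOpen {θ : Fin n → ℝ | θ ℓ < Real.pi / 2} :=
      isOpen_lt (by fun_prop) (by fun_prop)
    have h3 : IsOpen {θ : Fin n → ℝ | ∑ i ∈ A, Real.exp (θ i) < Real.cos (θ ℓ)} :=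
      isOpen_lt (by fun_prop) (by fun_prop)
    exact (h1.inter h2).inter h3
  · rintro θ ⟨_, h⟩
    rw [hsplit]
    linarith
  · rintro θ ⟨⟨h1, h2⟩, h⟩
    have hc := Real.cos_pos_of_mem_Ioo ⟨h1, h2⟩
    rw [laplace_geomMeasure_of_lt hc (hs θ) (laplace_secantMeasure_of_lt ℓ h1 h2)
      (laplace_unitMasses _ θ) h, hsplit]
    congr 2
    ring
  · intro θ h
    by_cases h12 : -(Real.pi / 2) < θ ℓ ∧ θ ℓ < Real.pi / 2
    · have hc := Real.cos_pos_of_mem_Ioo ⟨h12.1, h12.2⟩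
      refine laplace_geomMeasure_of_le hc (hs θ) (laplace_secantMeasure_of_lt ℓ h12.1 h12.2)
        (laplace_unitMasses _ θ) ?_
      by_contra hlt
      exact h ⟨h12, not_le.mp hlt⟩
    · exact laplace_geomMeasure_of_top (laplace_secantMeasure_of_not ℓ h12)
  · intro i x
    by_cases h : (i : ℕ) + 1 < n
    · simp only [hf''def, hf'def, h, if_true]
      exact Real.hasDerivAt_exp x
    · simp only [hf''def, hf'def, h, if_false]
      exact Real.hasDerivAt_sin x
  · rintro θ ⟨_, h⟩ i hi
    refine mul_pos (inv_pos.mpr ?_) ?_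
    · rw [hsplit]
      linarith
    · simp [hf'def, hi, Real.exp_pos]
  · intro m hm
    have hsum : 0 ≤ ∑ j ∈ A, m j := Finset.sum_nonneg fun j hj => (hm j (by simpa [hA] using hj)).le
    set s : ℝ := 1 + ∑ j ∈ A, m j with hsdef
    have hspos : 0 < s := by linarith
    -- With `D` the denominator, the equations are `exp (θ i) = m i * D`, `sin α = m ℓ * D` and `cos
    -- α = D + ∑ exp (θ i) = s * D`. Hence `tan α = m ℓ / s` and `D = cos α / s`.
    set α : ℝ := Real.arctan (m ℓ / s) with hα
    have hc : 0 < Real.cos α := Real.cos_arctan_pos _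
    have hαs : Real.sin α = m ℓ / s * Real.cos α := by
      rw [← Real.tan_arctan (m ℓ / s), ← hα, Real.tan_mul_cos hc.ne']
    set D : ℝ := Real.cos α / s with hD
    have hDpos : 0 < D := div_pos hc hspos
    set θ : Fin n → ℝ := fun i => if (i : ℕ) + 1 < n then Real.log (m i * D) else α with hθ
    have hθℓ : θ ℓ = α := by simp only [hθ, hℓA, if_false]
    have hexp : ∀ i : Fin n, (i : ℕ) + 1 < n → Real.exp (θ i) = m i * D := by
      intro i hi
      simp only [hθ, hi, if_true]
      exact Real.exp_log (mul_pos (hm i hi) hDpos)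
    have hsumexp : ∑ i ∈ A, Real.exp (θ i) = (s - 1) * D := by
      rw [hsdef, add_sub_cancel_left, Finset.sum_mul]
      exact Finset.sum_congr rfl fun i hi => hexp i (by simpa [hA] using hi)
    have hcD : Real.cos α = s * D := by
      rw [hD]
      field_simp
    refine ⟨θ, ⟨?_, ?_⟩, ?_⟩
    · rw [hθℓ]
      exact ⟨Real.neg_pi_div_two_lt_arctan _, Real.arctan_lt_pi_div_two _⟩
    · rw [hsumexp, hθℓ, hcD]
      linarith
    · ext i
      rw [hsplit, hsumexp, hθℓ, hcD, show 0 - ((s - 1) * D - s * D) = D by ring]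
      by_cases h : (i : ℕ) + 1 < n
      · simp only [hf'def, h, if_true, hexp i h]
        field_simp
      · have hi := (hlast i).mp h
        simp only [hf'def, h, if_false]
        rw [hi, hθℓ, hαs, hcD]
        field_simp
  · rintro θ ⟨_, h⟩ i
    have hpos : 0 < 0 - ∑ i, f i (θ i) := by
      rw [hsplit]
      linarith
    by_cases hi : (i : ℕ) + 1 < n
    · simp [hf''def, hf'def, hi]
    · rw [hsumA]
      have h1 : ∑ j ∈ A, (0 - ∑ i, f i (θ i))⁻¹ * f' j (θ j) =
          (0 - ∑ i, f i (θ i))⁻¹ * ∑ j ∈ A, Real.exp (θ j) := by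
        rw [Finset.mul_sum]
        refine Finset.sum_congr rfl fun j hj => ?_
        have hj' : (j : ℕ) + 1 < n := by simpa [hA] using hj
        simp only [hf'def, hj', if_true]
      rw [h1, if_neg hi]
      simp only [hf''def, hi, if_false]
      rw [(hlast i).mp hi]
      -- The last diagonal entry is `cos θ_ℓ / D`, with `D = cos θ_ℓ - ∑ exp (θ j)`; this is `1 + ∑
      -- exp (θ j) / D`.
      have h2 := hsplit θ
      field_simp
      rw [h2]
      ring
  · exact ⟨fun _ => 1, fun _ _ => one_pos⟩
  · intro m hm a ha
    have hsum : 0 ≤ ∑ j ∈ A, m j := Finset.sum_nonneg fun j hj => (hm j (by simpa [hA] using hj)).le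
    have hd : ∀ i : Fin n, 0 < if (i : ℕ) + 1 < n then m i
        else 1 + ∑ j : Fin n, if (j : ℕ) + 1 < n then m j else 0 := by
      intro i
      rw [hsumA]
      split_ifs with h
      · exact hm i h
      · linarith
    have h3 := Finset.sum_nonneg fun i (_ : i ∈ Finset.univ) =>
      mul_nonneg (hd i).le (sq_nonneg (a i))
    exact eq_zero_of_sum_mul_sq hd (by nlinarith [sq_nonneg (a ⬝ᵥ m)])

lemma VV_mem_casalisClass (n : ℕ) [NeZero n] : VV n ∈ casalisClass n := by
  refine mem_casalisClass_of_diagonal (isVarianceFunction_VV n) 1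
    (fun j i => if (i : ℕ) + 1 < n then (if i = j then 1 else 0)
      else (if (j : ℕ) + 1 < n then 1 else 0)) (fun i => if (i : ℕ) + 1 < n then 0 else 1) ?_
  intro m _
  simp only [VV, one_smul]
  congr 2
  ext i
  by_cases hi : (i : ℕ) + 1 < n <;> simp [hi, add_comm]

/-! ### Cubic matrix polynomials and linear pencils -/

/-- A linear map from `ℝⁿ⁺¹` to the matrices of order `n + 1`. -/
abbrev Pencil (n : ℕ) : Type :=
  (Fin n ⊕ Unit → ℝ) →ₗ[ℝ] Matrix (Fin n ⊕ Unit) (Fin n ⊕ Unit) ℝ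

/-- The vector `(m, 1)`. -/
def lift (m : Fin n → ℝ) : Fin n ⊕ Unit → ℝ := Sum.elim m fun _ => 1

/-- The matrix `[I, -m]`. -/
def proj (m : Fin n → ℝ) : Matrix (Fin n) (Fin n ⊕ Unit) ℝ :=
  Matrix.of fun i => Sum.elim (fun j => (1 : Matrix (Fin n) (Fin n) ℝ) i j) fun _ => -m i

/-- The cubic polynomial `[I, -m] L(m, 1) [I, -m]ᵀ`. -/
def cubic (L : Pencil n) (m : Fin n → ℝ) : Matrix (Fin n) (Fin n) ℝ :=
  proj m * L (lift m) * (proj m)ᵀ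

/-- The pencil `M ↦ g⁻¹ L(g M) (g⁻¹)ᵀ`. -/
def act (g : G n) (L : Pencil n) : Pencil n where
  toFun M := (g⁻¹ : G n).1 * L (g.1 *ᵥ M) * (g⁻¹ : G n).1ᵀ
  map_add' M N := by rw [mulVec_add, map_add, Matrix.mul_add, Matrix.add_mul]
  map_smul' r M := by
    rw [mulVec_smul, map_smul, Matrix.mul_smul, Matrix.smul_mul, RingHom.id_apply]

lemma act_apply (g : G n) (L : Pencil n) (M : Fin n ⊕ Unit → ℝ) :
    act g L M = (g⁻¹ : G n).1 * L (g.1 *ᵥ M) * (g⁻¹ : G n).1ᵀ := rfl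

lemma act_act (g h : G n) (L : Pencil n) : act g (act h L) = act (h * g) L := by
  refine LinearMap.ext fun M => ?_
  simp only [act_apply, _root_.mul_inv_rev, Units.val_mul, transpose_mul, mulVec_mulVec, Matrix.mul_assoc]

lemma act_one (L : Pencil n) : act 1 L = L := by
  refine LinearMap.ext fun M => ?_
  simp [act_apply]

lemma mulVec_lift_inl (g : G n) (m : Fin n → ℝ) (i : Fin n) :
    (g.1 *ᵥ lift m) (Sum.inl i) = (blockA g *ᵥ m + blockB g) i := by
  simp [mulVec, dotProduct, Fintype.sum_sum_type, lift, blockA, blockB, toBlocks₁₁]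

lemma mulVec_lift_inr (g : G n) (m : Fin n → ℝ) :
    (g.1 *ᵥ lift m) (Sum.inr ()) = denom g m := by
  simp [mulVec, dotProduct, Fintype.sum_sum_type, lift, blockC, blockD, denom]

lemma mulVec_lift {g : G n} {m : Fin n → ℝ} (h : denom g m ≠ 0) :
    g.1 *ᵥ lift m = denom g m • lift (homography g m) := by
  ext i
  rcases i with i | ⟨⟩
  · rw [mulVec_lift_inl]
    simp only [homography, lift, Pi.smul_apply, Sum.elim_inl, smul_eq_mul]
    field_simp
  · rw [mulVec_lift_inr]
    simp [lift]

lemma denom_mul {g h : G n} {m : Fin n → ℝ} (hg : denom g m ≠ 0) :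
    denom (h * g) m = denom g m * denom h (homography g m) := by
  rw [← mulVec_lift_inr, Units.val_mul, ← mulVec_mulVec, mulVec_lift hg, mulVec_smul, Pi.smul_apply,
    mulVec_lift_inr, smul_eq_mul]

lemma homography_mul {g h : G n} {m : Fin n → ℝ} (hg : denom g m ≠ 0) :
    homography (h * g) m = homography h (homography g m) := by
  ext i
  rw [homography, homography, denom_mul hg, Pi.smul_apply, Pi.smul_apply, ← mulVec_lift_inl,
    ← mulVec_lift_inl, Units.val_mul, ← mulVec_mulVec, mulVec_lift hg, mulVec_smul, Pi.smul_apply,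
    smul_eq_mul, smul_eq_mul, smul_eq_mul]
  field_simp

lemma homographyDeriv_eq {g : G n} {m : Fin n → ℝ} (h : denom g m ≠ 0) :
    homographyDeriv g m =
      (denom g m)⁻¹ • (blockA g - vecMulVec (homography g m) (blockC g)) := by
  let φ : (Fin n → ℝ) →ₗ[ℝ] ℝ :=
    { toFun := fun x => blockC g ⬝ᵥ x
      map_add' := dotProduct_add _
      map_smul' := fun r x => dotProduct_smul r _ x }
  have h1 : HasFDerivAt (denom g) φ.toContinuousLinearMap m :=
    φ.toContinuousLinearMap.hasFDerivAt.add_const (blockD g)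
  have h2 : HasFDerivAt (fun x => blockA g *ᵥ x + blockB g)
      (mulVecLin (blockA g)).toContinuousLinearMap m :=
    (mulVecLin (blockA g)).toContinuousLinearMap.hasFDerivAt.add_const (blockB g)
  have h3 : HasFDerivAt (homography g) _ m := ((hasDerivAt_inv h).comp_hasFDerivAt m h1).smul h2
  rw [homographyDeriv, h3.fderiv]
  ext i j
  have hφ : φ (Pi.single j 1) = blockC g j := dotProduct_single_one (blockC g) j
  simp only [LinearMap.toMatrix'_apply, homography, ContinuousLinearMap.coe_coe,
    _root_.add_apply, _root_.smul_apply, Pi.add_apply, Pi.smul_apply,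
    ContinuousLinearMap.smulRight_apply, LinearMap.coe_toContinuousLinearMap', mulVecLin_apply,
    mulVec_single_one, smul_eq_mul, hφ, col_apply, Matrix.smul_apply, Matrix.sub_apply,
    vecMulVec_apply, Function.comp_apply]
  field_simp
  ring

/-- This is how the Jacobian enters the linear picture: moving `g` across `[I, -h_g(m)]` produces
`h'_g(m)` and one factor `cᵀm + d`. -/
lemma proj_mul {g : G n} {m : Fin n → ℝ} (h : denom g m ≠ 0) :
    proj (homography g m) * g.1 = denom g m • (homographyDeriv g m * proj m) := by
  rw [homographyDeriv_eq h, Matrix.smul_mul, smul_smul, mul_inv_cancel₀ h, one_smul]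
  ext i j
  have hb : (blockA g *ᵥ m + blockB g) i = denom g m * homography g m i := by
    simp [homography, h]
  rcases j with j | ⟨⟩
  · simp [Matrix.mul_apply, Fintype.sum_sum_type, proj, Matrix.one_apply, blockA, blockC,
      toBlocks₁₁, vecMulVec_apply]
    ring
  · have e1 : (proj (homography g m) * g.1) i (Sum.inr ()) =
        blockB g i - homography g m i * blockD g := by
      simp [Matrix.mul_apply, Fintype.sum_sum_type, proj, Matrix.one_apply, blockB, blockD]
      ring
    have e2 : ((blockA g - vecMulVec (homography g m) (blockC g)) * proj m) i (Sum.inr ()) =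
        -((blockA g *ᵥ m) i) + homography g m i * (blockC g ⬝ᵥ m) := by
      simp only [Matrix.mul_apply, proj, of_apply, Sum.elim_inr, Matrix.sub_apply, vecMulVec_apply,
        mulVec, dotProduct, Finset.mul_sum, ← Finset.sum_neg_distrib, ← Finset.sum_add_distrib]
      exact Finset.sum_congr rfl fun j _ => by ring
    rw [e1, e2]
    rw [denom, Pi.add_apply] at hb
    linarith

/-- `J` is a right inverse of `[I, -h_g(m)]`. Inserting `g g⁻¹` and using `proj_mul` exhibits an
explicit right inverse of the Jacobian. -/
lemma homographyDeriv_inv_mul {g : G n} {m : Fin n → ℝ} (h : denom g m ≠ 0) :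
    (homographyDeriv g m)⁻¹ * homographyDeriv g m = 1 := by
  set J : Matrix (Fin n ⊕ Unit) (Fin n) ℝ := Matrix.of fun i j => Sum.elim
    (fun i => (1 : Matrix (Fin n) (Fin n) ℝ) i j) (fun _ => 0) i with hJ
  have hJ1 : proj (homography g m) * J = 1 := by
    ext i j
    simp [Matrix.mul_apply, Fintype.sum_sum_type, proj, hJ, Matrix.one_apply]
  have h1 : homographyDeriv g m * (denom g m • (proj m * (g⁻¹ : G n).1 * J)) = 1 := by
    rw [← hJ1, Matrix.mul_smul, ← Matrix.mul_assoc, ← Matrix.mul_assoc, ← Matrix.smul_mul,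
      ← Matrix.smul_mul, ← proj_mul h, Matrix.mul_assoc (proj _), ← Units.val_mul, mul_inv_cancel,
      Units.val_one, Matrix.mul_one]
  have hdet : IsUnit (homographyDeriv g m).det := isUnit_det_of_right_inverse h1
  exact nonsing_inv_mul _ hdet

/-- The two outer factors contribute `(cᵀm + d)²`, the argument `(h_g(m), 1)` contributes `(cᵀm +
d)⁻¹`, and the prefactor of `T` removes the remaining power; the Jacobians cancel. -/
lemma T_eq_cubic {g : G n} {V : MatrixFunction n} {L : Pencil n} {m : Fin n → ℝ}
    (h : 0 < denom g m) (hV : V.val (homography g m) = cubic L (homography g m)) :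
    T g V m = cubic (act g L) m := by
  have h0 := h.ne'
  have hp : proj (homography g m) =
      denom g m • (homographyDeriv g m * (proj m * (g⁻¹ : G n).1)) := by
    rw [← Matrix.mul_assoc, ← Matrix.smul_mul, ← proj_mul h0, Matrix.mul_assoc, ← Units.val_mul,
      mul_inv_cancel, Units.val_one, Matrix.mul_one]
  have hl : lift (homography g m) = (denom g m)⁻¹ • (g.1 *ᵥ lift m) := by
    rw [mulVec_lift h0, smul_smul, inv_mul_cancel₀ h0, one_smul]
  have hi := homographyDeriv_inv_mul h0
  have hi' : (homographyDeriv g m)ᵀ * ((homographyDeriv g m)ᵀ)⁻¹ = 1 := by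
    rw [← transpose_nonsing_inv, ← transpose_mul, hi, transpose_one]
  rw [T, hV, cubic, cubic, act_apply, hp, hl, map_smul]
  simp only [transpose_smul, transpose_mul, Matrix.smul_mul, Matrix.mul_smul, smul_smul]
  simp only [← Matrix.mul_assoc, hi, Matrix.one_mul]
  simp only [Matrix.mul_assoc, hi', Matrix.mul_one]
  convert one_smul ℝ _ using 2
  field_simp

/-- On pencils, acting by `h` and then by `g` is acting by `h * g`. The inclusion of domains ensures
that the composed transformation is defined wherever the second one was. -/
lemma GOrbit_subset {V V' : MatrixFunction n} {L : Pencil n} (h : G n)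
    (hV : ∀ m ∈ V.dom, V.val m = cubic L m) (hV' : ∀ m ∈ V'.dom, V'.val m = cubic (act h L) m)
    (hdom : V'.dom ⊆ pullback h V.dom) : GOrbit V' ⊆ GOrbit V := by
  rintro V₁ ⟨hvar, g, U, hU, hne, hU1, hUg, hT⟩
  have hmul : ∀ m ∈ U, denom (h * g) m = denom g m * denom h (homography g m) ∧
      homography (h * g) m = homography h (homography g m) := fun m hm =>
    ⟨denom_mul (hUg hm).1.ne', homography_mul (hUg hm).1.ne'⟩
  have hmem : U ⊆ pullback (h * g) V.dom := by
    intro m hm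
    have h1 := hdom (hUg hm).2
    refine ⟨?_, ?_⟩
    · rw [(hmul m hm).1]
      exact mul_pos (hUg hm).1 h1.1
    · rw [(hmul m hm).2]
      exact h1.2
  refine ⟨hvar, h * g, U, hU, hne, hU1, hmem, fun m hm => ?_⟩
  rw [hT m hm, T_eq_cubic (hUg hm).1 (hV' _ (hUg hm).2), act_act,
    T_eq_cubic (hmem hm).1 (hV _ (hmem hm).2)]

lemma GOrbit_eq {V V' : MatrixFunction n} {L : Pencil n} (h : G n)
    (hV : ∀ m ∈ V.dom, V.val m = cubic L m) (hV' : ∀ m ∈ V'.dom, V'.val m = cubic (act h L) m)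
    (hdom : V'.dom ⊆ pullback h V.dom) (hdom' : V.dom ⊆ pullback h⁻¹ V'.dom) :
    GOrbit V = GOrbit V' := by
  refine Set.Subset.antisymm (GOrbit_subset h⁻¹ hV' (fun m hm => ?_) hdom')
    (GOrbit_subset h hV hV' hdom)
  rw [act_act, mul_inv_cancel, act_one]
  exact hV m hm

lemma denom_one (m : Fin n → ℝ) : denom 1 m = 1 := by
  rw [← mulVec_lift_inr]
  simp [lift]

lemma homography_one (m : Fin n → ℝ) : homography 1 m = m := by
  ext i
  rw [homography, Pi.smul_apply, ← mulVec_lift_inl, denom_one]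
  simp [lift]

lemma self_mem_GOrbit {V : MatrixFunction n} {L : Pencil n} (hvar : IsVarianceFunction V)
    (hopen : IsOpen V.dom) (hne : V.dom.Nonempty) (hV : ∀ m ∈ V.dom, V.val m = cubic L m) :
    V ∈ GOrbit V := by
  have h1 : V.dom ⊆ pullback 1 V.dom := fun m hm => by
    refine ⟨?_, ?_⟩
    · rw [denom_one]
      exact one_pos
    · rwa [homography_one]
  refine ⟨hvar, 1, V.dom, hopen, hne, subset_rfl, h1, fun m hm => ?_⟩
  rw [T_eq_cubic (h1 hm).1 (hV _ (h1 hm).2), act_one]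
  exact hV m hm

/-! ### The pencils of the types -/

/-- The pencil `M ↦ diag(d M)`. -/
def diagPencil (d : (Fin n ⊕ Unit → ℝ) →ₗ[ℝ] (Fin n ⊕ Unit → ℝ)) : Pencil n :=
  diagonalLinearMap (Fin n ⊕ Unit) ℝ ℝ ∘ₗ d

lemma diagPencil_apply (d : (Fin n ⊕ Unit → ℝ) →ₗ[ℝ] (Fin n ⊕ Unit → ℝ))
    (M : Fin n ⊕ Unit → ℝ) : diagPencil d M = diagonal (d M) := rfl

lemma proj_mul_diagonal_mul (m : Fin n → ℝ) (d : Fin n ⊕ Unit → ℝ) :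
    proj m * diagonal d * (proj m)ᵀ =
      d (Sum.inr ()) • vecMulVec m m + diagonal fun i => d (Sum.inl i) := by
  ext i j
  rw [Matrix.mul_apply]
  simp only [mul_diagonal, transpose_apply, Fintype.sum_sum_type, proj, of_apply, Sum.elim_inl,
    Sum.elim_inr, Matrix.one_apply, ite_mul, one_mul, zero_mul, mul_ite, mul_one, mul_zero,
    Finset.sum_ite_eq, Finset.mem_univ, if_true, Finset.univ_unique, Finset.sum_singleton,
    Matrix.add_apply, Matrix.smul_apply, vecMulVec_apply, smul_eq_mul, diagonal_apply]
  rw [add_comm]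
  congr 1
  · change -m i * d (Sum.inr ()) * -m j = _
    ring
  · by_cases h : i = j
    · simp [h]
    · simp [h]

lemma cubic_diagPencil (d : (Fin n ⊕ Unit → ℝ) →ₗ[ℝ] (Fin n ⊕ Unit → ℝ)) (m : Fin n → ℝ) :
    cubic (diagPencil d) m = d (lift m) (Sum.inr ()) • vecMulVec m m +
      diagonal fun i => d (lift m) (Sum.inl i) := by
  rw [cubic, diagPencil_apply, proj_mul_diagonal_mul]

/-- The diagonal of the pencil of `VI n k`. -/
def diagI (n k : ℕ) : (Fin n ⊕ Unit → ℝ) →ₗ[ℝ] (Fin n ⊕ Unit → ℝ) where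
  toFun M := Sum.elim (fun i => if (i : ℕ) < k then M (Sum.inl i) else M (Sum.inr ())) fun _ => 0
  map_add' M N := by
    ext (i | i)
    · simp only [Pi.add_apply, Sum.elim_inl]
      split_ifs <;> rfl
    · simp
  map_smul' r M := by
    ext (i | i)
    · simp only [Pi.smul_apply, Sum.elim_inl, RingHom.id_apply]
      split_ifs <;> rfl
    · simp

/-- The diagonal of the pencil of `VII n`. -/
def diagII (n : ℕ) : (Fin n ⊕ Unit → ℝ) →ₗ[ℝ] (Fin n ⊕ Unit → ℝ) where
  toFun M := Sum.elim (fun i => M (Sum.inl i)) fun _ => -M (Sum.inr ())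
  map_add' M N := by
    ext (i | i) <;> simp [add_comm]
  map_smul' r M := by
    ext (i | i) <;> simp

/-- The diagonal of the pencil of `VV n`. -/
def diagV (n : ℕ) : (Fin n ⊕ Unit → ℝ) →ₗ[ℝ] (Fin n ⊕ Unit → ℝ) where
  toFun M := Sum.elim (fun i => if (i : ℕ) + 1 < n then M (Sum.inl i) else
    M (Sum.inr ()) + ∑ j : Fin n, if (j : ℕ) + 1 < n then M (Sum.inl j) else 0) fun _ => M (Sum.inr ())
  map_add' M N := by
    ext (i | i)
    · simp only [Pi.add_apply, Sum.elim_inl]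
      split_ifs
      · rfl
      · rw [add_add_add_comm, ← Finset.sum_add_distrib]
        congr 1
        refine Finset.sum_congr rfl fun j _ => ?_
        split_ifs <;> simp
    · simp
  map_smul' r M := by
    ext (i | i)
    · simp only [Pi.smul_apply, Sum.elim_inl, RingHom.id_apply, smul_eq_mul]
      split_ifs
      · rfl
      · rw [mul_add, Finset.mul_sum]
        congr 1
        refine Finset.sum_congr rfl fun j _ => ?_
        split_ifs <;> simp
    · simp

lemma VI_val_eq_cubic (n k : ℕ) (m : Fin n → ℝ) :
    (VI n k).val m = cubic (diagPencil (diagI n k)) m := by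
  rw [cubic_diagPencil]
  simp [VI, diagI, lift]

lemma VII_val_eq_cubic (n : ℕ) (m : Fin n → ℝ) :
    (VII n).val m = cubic (diagPencil (diagII n)) m := by
  rw [cubic_diagPencil]
  simp [VII, diagII, lift]

lemma VV_val_eq_cubic (n : ℕ) (m : Fin n → ℝ) :
    (VV n).val m = cubic (diagPencil (diagV n)) m := by
  rw [cubic_diagPencil]
  simp [VV, diagV, lift]

/-! ### Coincidences of orbits -/

/-- The element of `G` exchanging the coordinates `1` and `n + 1` of `ℝⁿ⁺¹`. -/
def swapG (n : ℕ) [NeZero n] : G n :=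
  let P := (Equiv.swap (Sum.inl (0 : Fin n)) (Sum.inr ())).permMatrix ℝ
  have h : P * P = 1 := by
    rw [← Matrix.permMatrix_mul, Equiv.swap_mul_self, Matrix.permMatrix_one]
  ⟨P, P, h, h⟩

lemma swapG_inv (n : ℕ) [NeZero n] : (swapG n)⁻¹ = swapG n := rfl

lemma swapG_mulVec [NeZero n] (M : Fin n ⊕ Unit → ℝ) :
    (swapG n).1 *ᵥ M = M ∘ Equiv.swap (Sum.inl 0) (Sum.inr ()) := by
  exact Matrix.permMatrix_mulVec _

lemma swapG_conj [NeZero n] (d : Fin n ⊕ Unit → ℝ) :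
    (swapG n).1 * diagonal d * (swapG n).1ᵀ =
      diagonal (d ∘ Equiv.swap (Sum.inl 0) (Sum.inr ())) := by
  change Equiv.Perm.permMatrix ℝ _ * diagonal d * (Equiv.Perm.permMatrix ℝ _)ᵀ = _
  rw [Matrix.transpose_permMatrix, Equiv.swap_inv, Equiv.Perm.permMatrix,
    PEquiv.toMatrix_toPEquiv_mul, PEquiv.mul_toMatrix_toPEquiv, submatrix_submatrix,
    Equiv.symm_swap]
  exact submatrix_diagonal_equiv d _

lemma isOpen_VI_dom (n k : ℕ) : IsOpen (VI n k).dom := by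
  have : (VI n k).dom = ⋂ i : Fin n, {m | (i : ℕ) < k → 0 < m i} := by
    ext m
    simp [VI]
  rw [this]
  refine isOpen_iInter_of_finite fun i => ?_
  by_cases h : (i : ℕ) < k
  · simp only [h, forall_const]
    exact isOpen_lt continuous_const (continuous_apply i)
  · simp [h]

/-- The exchange moves the zero entry of the diagonal from position `n + 1` to position `1`, and the
entry `M₁` to position `n + 1`, where it has become `M_{n+1} = 1`: this is the coefficient of `m
mᵀ`. It also turns the entries `M_{n+1}` into `M₁`. -/
lemma cubic_act_swapG [NeZero n] {k : ℕ} (hk : 1 ≤ k) (m : Fin n → ℝ) :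
    (VIV n k).val m = cubic (act (swapG n) (diagPencil (diagI n k))) m := by
  have h0k : ((0 : Fin n) : ℕ) < k := by simpa using Nat.lt_of_lt_of_le Nat.zero_lt_one hk
  rw [cubic, act_apply, swapG_inv, diagPencil_apply, swapG_conj, proj_mul_diagonal_mul,
    swapG_mulVec]
  have h1 : ∀ i : Fin n, i ≠ 0 →
      Equiv.swap (Sum.inl (0 : Fin n)) (Sum.inr ()) (Sum.inl i) = Sum.inl i := fun i hi =>
    Equiv.swap_apply_of_ne_of_ne (by simpa using hi) (by simp)
  simp only [VIV, Function.comp_apply, Equiv.swap_apply_right]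
  congr 1
  · rw [diagI]
    simp only [LinearMap.coe_mk, AddHom.coe_mk, Sum.elim_inl, h0k, if_true, Function.comp_apply,
      Equiv.swap_apply_left, lift, Sum.elim_inr, one_smul]
  · congr 1
    ext i
    by_cases hi : i = 0
    · rw [hi, Equiv.swap_apply_left]
      simp [diagI]
    · rw [h1 i hi]
      by_cases h : (i : ℕ) < k
      · simp [diagI, hi, h, h1 i hi, lift]
      · simp [diagI, hi, h, lift]

lemma VI_dom_subset_pullback_swapG [NeZero n] {k : ℕ} (hk : 1 ≤ k) :
    (VI n k).dom ⊆ pullback (swapG n) (VI n k).dom := by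
  intro m hm
  have h0k : ((0 : Fin n) : ℕ) < k := by simpa using Nat.lt_of_lt_of_le Nat.zero_lt_one hk
  have hm0 : 0 < m 0 := hm 0 h0k
  have hd : denom (swapG n) m = m 0 := by
    rw [← mulVec_lift_inr, swapG_mulVec]
    simp [lift]
  refine ⟨by rwa [hd], fun i hi => ?_⟩
  rw [homography, Pi.smul_apply, ← mulVec_lift_inl, hd, swapG_mulVec, smul_eq_mul]
  refine mul_pos (inv_pos.mpr hm0) ?_
  by_cases h : i = 0
  · simp [h, lift]
  · rw [Function.comp_apply, Equiv.swap_apply_of_ne_of_ne (by simpa using h) (by simp)]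
    exact hm i hi

lemma GOrbit_VI_eq_GOrbit_VIV [NeZero n] {k : ℕ} (hk : 1 ≤ k) :
    GOrbit (VI n k) = GOrbit (VIV n k) :=
  -- The two types have the same domain and the exchange is an involution, so a single inclusion
  -- serves in both directions.
  GOrbit_eq (swapG n) (fun m _ => VI_val_eq_cubic n k m) (fun m _ => cubic_act_swapG hk m)
    (VI_dom_subset_pullback_swapG hk) (VI_dom_subset_pullback_swapG hk)

lemma VIV_mem_GOrbit_VI [NeZero n] {k : ℕ} (hk : 1 ≤ k) : VIV n k ∈ GOrbit (VI n k) := by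
  rw [GOrbit_VI_eq_GOrbit_VIV hk]
  exact self_mem_GOrbit (isVarianceFunction_VIV n hk) (isOpen_VI_dom n k)
    ⟨fun _ => 1, fun _ _ => one_pos⟩ fun m _ => cubic_act_swapG hk m

/-- The matrix `[I 0; s ⋯ s 1]`. -/
def sumMatrix (n : ℕ) (s : ℝ) : Matrix (Fin n ⊕ Unit) (Fin n ⊕ Unit) ℝ :=
  fromBlocks 1 0 (Matrix.of fun _ _ => s) 1

lemma sumMatrix_mul (s t : ℝ) : sumMatrix n s * sumMatrix n t = sumMatrix n (s + t) := by
  rw [sumMatrix, sumMatrix, fromBlocks_multiply, sumMatrix]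
  simp only [Matrix.mul_one, Matrix.one_mul, Matrix.mul_zero, Matrix.zero_mul, add_zero, zero_add]
  rfl

lemma sumMatrix_zero : sumMatrix n 0 = 1 := fromBlocks_one

/-- The element `(m, t) ↦ (m, t + s (m₁ + ⋯ + mₙ))` of `G`. -/
def sumG (n : ℕ) (s : ℝ) : G n :=
  ⟨sumMatrix n s, sumMatrix n (-s), by rw [sumMatrix_mul, add_neg_cancel, sumMatrix_zero],
    by rw [sumMatrix_mul, neg_add_cancel, sumMatrix_zero]⟩

lemma sumG_inv (s : ℝ) : (sumG n s)⁻¹ = sumG n (-s) := by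
  ext1
  rfl

lemma sumG_mulVec_inl (s : ℝ) (M : Fin n ⊕ Unit → ℝ) (i : Fin n) :
    ((sumG n s).1 *ᵥ M) (Sum.inl i) = M (Sum.inl i) := by
  simp [sumG, sumMatrix, mulVec, dotProduct, Fintype.sum_sum_type, Matrix.one_apply]

lemma sumG_mulVec_inr (s : ℝ) (M : Fin n ⊕ Unit → ℝ) :
    ((sumG n s).1 *ᵥ M) (Sum.inr ()) = s * ∑ i, M (Sum.inl i) + M (Sum.inr ()) := by
  simp [sumG, sumMatrix, mulVec, dotProduct, Fintype.sum_sum_type, Finset.mul_sum]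

lemma denom_sumG (s : ℝ) (m : Fin n → ℝ) : denom (sumG n s) m = s * ∑ i, m i + 1 := by
  rw [← mulVec_lift_inr, sumG_mulVec_inr]
  rfl

lemma homography_sumG (s : ℝ) (m : Fin n → ℝ) (i : Fin n) :
    homography (sumG n s) m i = (s * ∑ i, m i + 1)⁻¹ * m i := by
  rw [homography, Pi.smul_apply, ← mulVec_lift_inl, denom_sumG, sumG_mulVec_inl]
  rfl

/-- Here `[I, -m] g⁻¹ = [I + m 1ᵀ, -m]` and the diagonal is `(m, -(1 + ∑ m i))`. Expanding, the
terms `(∑ m i) m mᵀ` cancel and `2 m mᵀ - m mᵀ` remains beside `diag m`. -/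
lemma cubic_act_sumG (m : Fin n → ℝ) :
    (VIII n).val m = cubic (act (sumG n 1) (diagPencil (diagII n))) m := by
  have h1 : diagII n ((sumG n 1).1 *ᵥ lift m) = Sum.elim m fun _ => -(∑ i, m i + 1) := by
    ext (i | ⟨⟩)
    · simp only [diagII, LinearMap.coe_mk, AddHom.coe_mk, Sum.elim_inl, sumG_mulVec_inl]
      rfl
    · simp only [diagII, LinearMap.coe_mk, AddHom.coe_mk, Sum.elim_inr, sumG_mulVec_inr, one_mul]
      rfl
  have h2 : proj m * (sumG n (-1)).1 =
      Matrix.of fun i => Sum.elim (fun j => (if i = j then 1 else 0) + m i) fun _ => -m i := by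
    ext i (j | ⟨⟩)
    · simp [Matrix.mul_apply, Fintype.sum_sum_type, proj, sumG, sumMatrix, Matrix.one_apply]
    · simp [Matrix.mul_apply, Fintype.sum_sum_type, proj, sumG, sumMatrix, Matrix.one_apply]
  rw [cubic, act_apply, sumG_inv, diagPencil_apply, h1, ← Matrix.mul_assoc, ← Matrix.mul_assoc,
    Matrix.mul_assoc _ _ (proj m)ᵀ, ← transpose_mul, h2]
  ext i j
  rw [Matrix.mul_apply]
  simp only [mul_diagonal, transpose_apply, Fintype.sum_sum_type, of_apply, Sum.elim_inl,
    Sum.elim_inr, Finset.univ_unique, Finset.sum_singleton, VIII, Matrix.add_apply,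
    vecMulVec_apply, diagonal_apply]
  have h3 : ∀ l, ((if i = l then 1 else 0) + m i) * m l * ((if j = l then 1 else 0) + m j) =
      (if i = l then (if j = l then m l else 0) else 0) + (if i = l then m l * m j else 0) +
        (if j = l then m i * m l else 0) + m i * m j * m l := by
    intro l
    split_ifs <;> ring
  simp_rw [h3, Finset.sum_add_distrib, ← Finset.mul_sum]
  simp only [Finset.sum_ite_eq, Finset.mem_univ, if_true]
  by_cases h : i = j
  · simp only [h, if_true]
    ring
  · simp only [h, Ne.symm h, if_false]
    ring

lemma VIII_dom_subset_pullback : (VIII n).dom ⊆ pullback (sumG n 1) (VII n).dom := by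
  intro m hm
  have hm' : ∀ i, 0 < m i := hm
  have hs : 0 ≤ ∑ i, m i := Finset.sum_nonneg fun i _ => (hm' i).le
  have hd : 0 < 1 * ∑ i, m i + 1 := by linarith
  refine ⟨by rwa [denom_sumG], fun i => ?_, ?_⟩
  · rw [homography_sumG]
    exact mul_pos (inv_pos.mpr hd) (hm' i)
  · simp_rw [homography_sumG]
    rw [← Finset.mul_sum, ← div_eq_inv_mul, div_lt_one hd]
    linarith

lemma VII_dom_subset_pullback : (VII n).dom ⊆ pullback (sumG n 1)⁻¹ (VIII n).dom := by
  rintro m ⟨hm, hm1⟩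
  have hd : 0 < -1 * ∑ i, m i + 1 := by linarith
  rw [sumG_inv]
  refine ⟨by rwa [denom_sumG], fun i => ?_⟩
  rw [homography_sumG]
  exact mul_pos (inv_pos.mpr hd) (hm i)

lemma GOrbit_VII_eq_GOrbit_VIII (n : ℕ) : GOrbit (VII n) = GOrbit (VIII n) :=
  GOrbit_eq (sumG n 1) (fun m _ => VII_val_eq_cubic n m) (fun m _ => cubic_act_sumG m)
    VIII_dom_subset_pullback VII_dom_subset_pullback

lemma VIII_mem_GOrbit_VII (n : ℕ) : VIII n ∈ GOrbit (VII n) := by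
  rw [GOrbit_VII_eq_GOrbit_VIII]
  refine self_mem_GOrbit (isVarianceFunction_VIII n) ?_ ⟨fun _ => 1, fun _ => one_pos⟩
    fun m _ => cubic_act_sumG m
  have : (VIII n).dom = ⋂ i : Fin n, {m | 0 < m i} := by
    ext m
    simp [VIII]
  rw [this]
  exact isOpen_iInter_of_finite fun i => isOpen_lt continuous_const (continuous_apply i)

/-! ### A variance function is determined by its restriction to an open set -/

/-- Convexity of the exponential. It makes the traces of `Θ(μ)` on lines connected, as the identity
theorem requires. -/
lemma convex_laplaceDomain (μ : Measure (Fin n → ℝ)) : Convex ℝ (laplaceDomain μ) := by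
  intro θ hθ η hη a b ha hb hab
  have hθ' : Integrable (fun x => Real.exp (θ ⬝ᵥ x)) μ := hθ
  have hη' : Integrable (fun x => Real.exp (η ⬝ᵥ x)) μ := hη
  refine Integrable.mono' ((hθ'.const_mul a).add (hη'.const_mul b))
    (measurable_exp_dotProduct _).aestronglyMeasurable (Eventually.of_forall fun x => ?_)
  rw [Real.norm_of_nonneg (Real.exp_pos _).le, add_dotProduct, smul_dotProduct, smul_dotProduct]
  exact convexOn_exp.2 (Set.mem_univ _) (Set.mem_univ _) ha hb hab

/-- The set of the `t` such that `θ + t w` is in the domain of the family. -/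
def lineDomain (μ : Measure (Fin n → ℝ)) (θ w : Fin n → ℝ) : Set ℝ :=
  {t | θ + t • w ∈ naturalDomain μ}

lemma isOpen_lineDomain (μ : Measure (Fin n → ℝ)) (θ w : Fin n → ℝ) :
    IsOpen (lineDomain μ θ w) :=
  (isOpen_naturalDomain μ).preimage (by fun_prop)

lemma isPreconnected_lineDomain (μ : Measure (Fin n → ℝ)) (θ w : Fin n → ℝ) :
    IsPreconnected (lineDomain μ θ w) := by
  refine Convex.isPreconnected fun s hs t ht a b ha hb hab => ?_
  have := (convex_laplaceDomain μ).interior hs ht ha hb hab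
  change θ + (a • s + b • t) • w ∈ interior (laplaceDomain μ)
  convert this using 1
  rw [smul_add, smul_add, add_add_add_comm, ← add_smul, hab, one_smul, add_smul, smul_smul,
    smul_smul, smul_eq_mul, smul_eq_mul]

/-- A nonnegative weight can be absorbed into the measure, so the integral is a moment generating
function in `t`, analytic inside its domain. -/
lemma analyticOnNhd_integral_of_nonneg {μ : Measure (Fin n → ℝ)} {θ w : Fin n → ℝ}
    {p : (Fin n → ℝ) → ℝ} (hp : Measurable p) (hp0 : ∀ x, 0 ≤ p x)
    (hint : ∀ η ∈ naturalDomain μ, Integrable (fun x => Real.exp (η ⬝ᵥ x) * p x) μ) :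
    AnalyticOnNhd ℝ (fun t : ℝ => ∫ x, Real.exp ((θ + t • w) ⬝ᵥ x) * p x ∂μ)
      (lineDomain μ θ w) := by
  have hm : Measurable fun x => Real.exp (θ ⬝ᵥ x) * p x := (measurable_exp_dotProduct θ).mul hp
  have hnn : ∀ x, 0 ≤ Real.exp (θ ⬝ᵥ x) * p x := fun x => mul_nonneg (Real.exp_pos _).le (hp0 x)
  set ν := μ.withDensity fun x => ENNReal.ofReal (Real.exp (θ ⬝ᵥ x) * p x) with hν
  have heq : ∀ (t : ℝ) (x : Fin n → ℝ), (Real.exp (θ ⬝ᵥ x) * p x) * Real.exp (t * (w ⬝ᵥ x)) =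
      Real.exp ((θ + t • w) ⬝ᵥ x) * p x := by
    intro t x
    rw [add_dotProduct, smul_dotProduct, Real.exp_add, smul_eq_mul]
    ring
  have hmgf : (fun t : ℝ => ∫ x, Real.exp ((θ + t • w) ⬝ᵥ x) * p x ∂μ) =
      mgf (fun x => w ⬝ᵥ x) ν := by
    ext t
    rw [mgf, hν, integral_withDensity_eq_integral_toReal_smul hm.ennreal_ofReal
      (Eventually.of_forall fun x => ENNReal.ofReal_lt_top)]
    refine integral_congr_ae (Eventually.of_forall fun x => ?_)
    simp only [smul_eq_mul]
    rw [ENNReal.toReal_ofReal (hnn x), heq]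
  rw [hmgf]
  refine (analyticOnNhd_mgf (X := fun x => w ⬝ᵥ x) (μ := ν)).mono
    (interior_maximal (fun t ht => ?_) (isOpen_lineDomain μ θ w))
  change Integrable _ _
  rw [hν, integrable_withDensity_iff_integrable_smul' hm.ennreal_ofReal
    (Eventually.of_forall fun x => ENNReal.ofReal_lt_top)]
  refine (hint _ ht).congr (Eventually.of_forall fun x => ?_)
  simp only [smul_eq_mul]
  rw [ENNReal.toReal_ofReal (hnn x), heq]

lemma analyticOnNhd_integral {μ : Measure (Fin n → ℝ)} {θ w : Fin n → ℝ}
    {p : (Fin n → ℝ) → ℝ} (hp : Measurable p)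
    (hint : ∀ η ∈ naturalDomain μ, Integrable (fun x => Real.exp (η ⬝ᵥ x) * p x) μ) :
    AnalyticOnNhd ℝ (fun t : ℝ => ∫ x, Real.exp ((θ + t • w) ⬝ᵥ x) * p x ∂μ)
      (lineDomain μ θ w) := by
  have hmax : ∀ (q : (Fin n → ℝ) → ℝ), Measurable q →
      (∀ η ∈ naturalDomain μ, Integrable (fun x => Real.exp (η ⬝ᵥ x) * q x) μ) →
      ∀ η ∈ naturalDomain μ, Integrable (fun x => Real.exp (η ⬝ᵥ x) * max (q x) 0) μ := by
    intro q hq hqi η hη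
    refine Integrable.mono (hqi η hη)
      ((measurable_exp_dotProduct η).mul (hq.max measurable_const)).aestronglyMeasurable
      (Eventually.of_forall fun x => ?_)
    rw [norm_mul, norm_mul]
    refine mul_le_mul_of_nonneg_left ?_ (norm_nonneg _)
    rw [Real.norm_eq_abs, Real.norm_eq_abs, abs_of_nonneg (le_max_right _ _)]
    exact max_le (le_abs_self _) (abs_nonneg _)
  have hneg : ∀ η ∈ naturalDomain μ, Integrable (fun x => Real.exp (η ⬝ᵥ x) * -p x) μ := by
    intro η hη
    simpa using (hint η hη).neg
  have h1 := analyticOnNhd_integral_of_nonneg (θ := θ) (w := w) (hp.max measurable_const)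
    (fun x => le_max_right _ _) (hmax p hp hint)
  have h2 := analyticOnNhd_integral_of_nonneg (θ := θ) (w := w) (p := fun x => max (-p x) 0)
    (hp.neg.max measurable_const)
    (fun x => le_max_right _ _) (hmax (fun x => -p x) hp.neg hneg)
  -- A signed weight is the difference of its positive and negative parts, each covered by the
  -- nonnegative case.
  refine (h1.sub h2).congr (isOpen_lineDomain μ θ w) fun t ht => ?_
  rw [Pi.sub_apply, ← integral_sub (hmax p hp hint _ ht) (hmax (fun x => -p x) hp.neg hneg _ ht)]
  refine integral_congr_ae (Eventually.of_forall fun x => ?_)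
  simp only
  rw [← mul_sub, max_zero_sub_max_neg_zero_eq_self]

lemma analyticOnNhd_integral_nef {μ : Measure (Fin n → ℝ)} [NeZero μ] {θ w : Fin n → ℝ}
    {p : (Fin n → ℝ) → ℝ} (hp : Measurable p)
    (hint : ∀ η ∈ naturalDomain μ, Integrable p (nef μ η)) :
    AnalyticOnNhd ℝ (fun t : ℝ => ∫ x, p x ∂(nef μ (θ + t • w))) (lineDomain μ θ w) := by
  have hint' : ∀ η ∈ naturalDomain μ, Integrable (fun x => Real.exp (η ⬝ᵥ x) * p x) μ :=
    fun η hη => (integrable_tilted_iff (integrable_of_mem_naturalDomain hη) p).mp (hint η hη)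
  have h1 := analyticOnNhd_integral (θ := θ) (w := w) hp hint'
  have h2 := analyticOnNhd_integral (μ := μ) (θ := θ) (w := w) (p := fun _ => 1)
    measurable_const fun η hη => by simpa using integrable_of_mem_naturalDomain hη
  refine (h1.div h2 fun t ht => ?_).congr (isOpen_lineDomain μ θ w) fun t ht => ?_
  · simp only [mul_one]
    exact (integral_exp_pos (integrable_of_mem_naturalDomain ht)).ne'
  · rw [nef, integral_tilted, ← integral_div]
    refine integral_congr_ae (Eventually.of_forall fun x => ?_)
    simp only [mul_one, smul_eq_mul]
    ring

lemma analyticOnNhd_nefMean {μ : Measure (Fin n → ℝ)} [NeZero μ] (θ w : Fin n → ℝ) (i : Fin n) :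
    AnalyticOnNhd ℝ (fun t : ℝ => nefMean μ (θ + t • w) i) (lineDomain μ θ w) := by
  refine analyticOnNhd_integral_nef (by fun_prop) fun η hη => ?_
  have := isProbabilityMeasure_nef hη
  exact (memLp_coord_nef hη i).integrable (by norm_num)

lemma analyticOnNhd_nefCov {μ : Measure (Fin n → ℝ)} [NeZero μ] (θ w : Fin n → ℝ)
    (i j : Fin n) :
    AnalyticOnNhd ℝ (fun t : ℝ => nefCov μ (θ + t • w) i j) (lineDomain μ θ w) := by
  have h1 := analyticOnNhd_integral_nef (μ := μ) (θ := θ) (w := w)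
    (p := fun x => x i * x j) (by fun_prop)
    fun η hη => (memLp_coord_nef hη i).integrable_mul (memLp_coord_nef hη j)
  refine (h1.sub ((analyticOnNhd_nefMean θ w i).mul (analyticOnNhd_nefMean θ w j))).congr
    (isOpen_lineDomain μ θ w) fun t ht => ?_
  have := isProbabilityMeasure_nef ht
  rw [nefCov, of_apply, covariance_eq_sub (memLp_coord_nef ht i) (memLp_coord_nef ht j)]
  rfl

lemma pencil_apply_eq_sum (L : Pencil n) (M : Fin n ⊕ Unit → ℝ) (a b : Fin n ⊕ Unit) :
    L M a b = ∑ c, M c * L (Pi.single c 1) a b := by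
  conv_lhs => rw [pi_eq_sum_univ' M, map_sum]
  rw [Matrix.sum_apply]
  refine Finset.sum_congr rfl fun c _ => ?_
  rw [map_smul, Matrix.smul_apply, smul_eq_mul]

lemma analyticAt_cubic {m : ℝ → Fin n → ℝ} {t : ℝ} (hm : ∀ i, AnalyticAt ℝ (fun s => m s i) t)
    (L : Pencil n) (i j : Fin n) : AnalyticAt ℝ (fun s => cubic L (m s) i j) t := by
  have hlift : ∀ c, AnalyticAt ℝ (fun s => lift (m s) c) t := by
    rintro (c | c)
    · exact hm c
    · exact analyticAt_const
  have hproj : ∀ i c, AnalyticAt ℝ (fun s => proj (m s) i c) t := by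
    rintro i (c | c)
    · exact analyticAt_const
    · exact (hm i).neg
  have hL : ∀ a b, AnalyticAt ℝ (fun s => L (lift (m s)) a b) t := by
    intro a b
    rw [funext fun s => pencil_apply_eq_sum L (lift (m s)) a b]
    exact Finset.analyticAt_fun_sum _ fun c _ => (hlift c).mul analyticAt_const
  simp only [cubic, Matrix.mul_apply, transpose_apply]
  exact Finset.analyticAt_fun_sum _ fun a _ => AnalyticAt.mul
    (Finset.analyticAt_fun_sum _ fun b _ => (hproj _ _).mul (hL _ _)) (hproj _ _)

/-- Join a parameter with mean in `U` to an arbitrary one by a segment. Covariance minus cubic is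
analytic along it and vanishes near its start by continuity of the mean, hence also at its end. -/
lemma eq_cubic_of_eq_on_open [NeZero n] {V : MatrixFunction n} (hV : IsVarianceFunction V)
    {L : Pencil n} {U : Set (Fin n → ℝ)} (hU : IsOpen U) (hne : U.Nonempty) (hUV : U ⊆ V.dom)
    (h : ∀ m ∈ U, V.val m = cubic L m) : ∀ m ∈ V.dom, V.val m = cubic L m := by
  obtain ⟨μ, hμ, hdom, hcov⟩ := hV
  -- The zero measure is concentrated on every hyperplane; a nonzero normal vector exists because `n
  -- ≥ 1`.
  have : NeZero μ := ⟨by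
    rintro rfl
    exact hμ.not_hyperplane (fun _ => 1) 0 (fun h0 => one_ne_zero (congrFun h0 (0 : Fin n)))
      (by simp)⟩
  intro m hm
  rw [hdom] at hm hUV
  obtain ⟨θ₁, hθ₁, rfl⟩ := hm
  obtain ⟨m₀, hm₀⟩ := hne
  obtain ⟨θ₀, hθ₀, rfl⟩ := hUV hm₀
  have h0 : (0 : ℝ) ∈ lineDomain μ θ₀ (θ₁ - θ₀) := by simpa [lineDomain] using hθ₀
  have h1 : (1 : ℝ) ∈ lineDomain μ θ₀ (θ₁ - θ₀) := by simpa [lineDomain] using hθ₁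
  have hmean : ContinuousAt (fun t : ℝ => nefMean μ (θ₀ + t • (θ₁ - θ₀))) 0 :=
    continuousAt_pi.mpr fun i => (analyticOnNhd_nefMean θ₀ _ i 0 h0).continuousAt
  have hev : ∀ᶠ t : ℝ in 𝓝 0, nefMean μ (θ₀ + t • (θ₁ - θ₀)) ∈ U := by
    apply hmean.eventually_mem
    simpa using hU.mem_nhds hm₀
  rw [hcov θ₁ hθ₁]
  ext i j
  have hzero := AnalyticOnNhd.eqOn_zero_of_preconnected_of_eventuallyEq_zero
    (f := fun t : ℝ => nefCov μ (θ₀ + t • (θ₁ - θ₀)) i j -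
      cubic L (nefMean μ (θ₀ + t • (θ₁ - θ₀))) i j)
    (fun t ht => (analyticOnNhd_nefCov θ₀ _ i j t ht).sub
      (analyticAt_cubic (fun i => analyticOnNhd_nefMean θ₀ _ i t ht) L i j))
    (isPreconnected_lineDomain μ θ₀ (θ₁ - θ₀)) h0 (by
      filter_upwards [hev, (isOpen_lineDomain μ θ₀ (θ₁ - θ₀)).mem_nhds h0] with t ht ht'
      rw [← hcov _ ht', h _ ht, sub_self, Pi.zero_apply]) h1
  simpa [sub_eq_zero] using hzero

/-! ### Invariants of pencils -/

/-- The quadratic forms of the pencil `D` are multiples of the linear forms. -/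
def IsScalar (D : Pencil n) : Prop :=
  ∀ ξ : Fin n ⊕ Unit → ℝ, ∃ c : ℝ, ∀ M, ξ ⬝ᵥ D M *ᵥ ξ = c * (ξ ⬝ᵥ M)

/-- The forms vanishing at `(m, 1)` are the combinations of the rows of `[I, -m]`, so the cubic
records the quadratic form of `D(m, 1)` on exactly these forms. -/
lemma quadratic_eq_zero_of_cubic_eq_zero {D : Pencil n} {m : Fin n → ℝ} (h : cubic D m = 0)
    {s : ℝ} {ζ : Fin n ⊕ Unit → ℝ} (hζ : ζ ⬝ᵥ lift m = 0) :
    ζ ⬝ᵥ D (s • lift m) *ᵥ ζ = 0 := by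
  have h1 : ζ = (proj m)ᵀ *ᵥ fun i => ζ (Sum.inl i) := by
    ext (i | ⟨⟩)
    · simp [mulVec, dotProduct, proj, Matrix.one_apply]
    · have h2 : (∑ i, ζ (Sum.inl i) * m i) + ζ (Sum.inr ()) = 0 := by
        simpa [dotProduct, Fintype.sum_sum_type, lift] using hζ
      simp only [mulVec, dotProduct, transpose_apply, proj, of_apply, Sum.elim_inr, neg_mul,
        Finset.sum_neg_distrib]
      rw [eq_neg_iff_add_eq_zero, add_comm, ← h2]
      congr 1
      exact Finset.sum_congr rfl fun i _ => mul_comm _ _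
  rw [map_smul, smul_mulVec, dotProduct_smul]
  have h3 : ζ ⬝ᵥ D (lift m) *ᵥ ζ =
      (fun i => ζ (Sum.inl i)) ⬝ᵥ cubic D m *ᵥ fun i => ζ (Sum.inl i) := by
    rw [cubic, ← mulVec_mulVec, ← mulVec_mulVec, ← h1, dotProduct_mulVec, dotProduct_mulVec,
      dotProduct_mulVec, ← mulVec_transpose (proj m), ← h1]
  rw [h3, h, zero_mulVec, dotProduct_zero, smul_zero]

lemma isScalar_of_cubic_eq_zero {D : Pencil n} {U : Set (Fin n → ℝ)} (hU : IsOpen U)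
    (hne : U.Nonempty) (h : ∀ m ∈ U, cubic D m = 0) : IsScalar D := by
  obtain ⟨m₀, hm₀⟩ := hne
  -- The form `(α·M) ξ - (ξ·M) α` vanishes at `M`. The expression is therefore zero when `M` is near
  -- `(m₀, 1)`, since its projective point lies in `U`; being polynomial in `t` along a line from
  -- `(m₀, 1)`, it is zero for every `M`.
  have key : ∀ (ξ α M : Fin n ⊕ Unit → ℝ),
      ((α ⬝ᵥ M) • ξ - (ξ ⬝ᵥ M) • α) ⬝ᵥ D M *ᵥ ((α ⬝ᵥ M) • ξ - (ξ ⬝ᵥ M) • α) = 0 := by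
    intro ξ α M
    set F : (Fin n ⊕ Unit → ℝ) → ℝ := fun M =>
      ((α ⬝ᵥ M) • ξ - (ξ ⬝ᵥ M) • α) ⬝ᵥ D M *ᵥ ((α ⬝ᵥ M) • ξ - (ξ ⬝ᵥ M) • α) with hF
    set γ : ℝ → Fin n ⊕ Unit → ℝ := fun t => lift m₀ + t • (M - lift m₀) with hγ
    have hγa : ∀ t a, AnalyticAt ℝ (fun s => γ s a) t := by
      intro t a
      simp only [hγ, Pi.add_apply, Pi.smul_apply, smul_eq_mul]
      fun_prop
    have hdot : ∀ (β : Fin n ⊕ Unit → ℝ) t, AnalyticAt ℝ (fun s => β ⬝ᵥ γ s) t := fun β t =>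
      Finset.analyticAt_fun_sum _ fun a _ => analyticAt_const.mul (hγa t a)
    have hζ : ∀ t a, AnalyticAt ℝ (fun s => ((α ⬝ᵥ γ s) • ξ - (ξ ⬝ᵥ γ s) • α) a) t := fun t a =>
      ((hdot α t).mul analyticAt_const).sub ((hdot ξ t).mul analyticAt_const)
    have hD : ∀ t a b, AnalyticAt ℝ (fun s => D (γ s) a b) t := by
      intro t a b
      rw [funext fun s => pencil_apply_eq_sum D (γ s) a b]
      exact Finset.analyticAt_fun_sum _ fun c _ => (hγa t c).mul analyticAt_const
    have hDζ : ∀ t a, AnalyticAt ℝ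
        (fun s => (D (γ s) *ᵥ ((α ⬝ᵥ γ s) • ξ - (ξ ⬝ᵥ γ s) • α)) a) t := fun t a =>
      Finset.analyticAt_fun_sum Finset.univ fun b _ => (hD t a b).mul (hζ t b)
    have hFa : AnalyticOnNhd ℝ (fun t => F (γ t)) Set.univ := fun t _ =>
      Finset.analyticAt_fun_sum Finset.univ fun a _ => (hζ t a).mul (hDζ t a)
    have hγc : ∀ a, ContinuousAt (fun s => γ s a) 0 := fun a => (hγa 0 a).continuousAt
    have hγ0 : γ 0 = lift m₀ := by simp [hγ]
    have hγinr : γ 0 (Sum.inr ()) = 1 := by rw [hγ0]; rfl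
    have hpos : ∀ᶠ t in 𝓝 0, 0 < γ t (Sum.inr ()) := by
      apply (hγc _).eventually_mem
      rw [hγinr]
      exact Ioi_mem_nhds one_pos
    have hmem : ∀ᶠ t in 𝓝 0, (fun i => (γ t (Sum.inr ()))⁻¹ * γ t (Sum.inl i)) ∈ U := by
      have hc : ContinuousAt (fun t i => (γ t (Sum.inr ()))⁻¹ * γ t (Sum.inl i)) 0 := by
        refine continuousAt_pi.mpr fun i => ((hγc _).inv₀ ?_).mul (hγc _)
        rw [hγinr]
        exact one_ne_zero
      apply hc.eventually_mem
      have : (fun i => (γ 0 (Sum.inr ()))⁻¹ * γ 0 (Sum.inl i)) = m₀ := by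
        ext i
        rw [hγinr, hγ0, inv_one, one_mul]
        rfl
      rw [this]
      exact hU.mem_nhds hm₀
    have hzero := hFa.eqOn_zero_of_preconnected_of_eventuallyEq_zero isPreconnected_univ
      (Set.mem_univ 0) (by
        filter_upwards [hpos, hmem] with t ht ht'
        have hlift : γ t = γ t (Sum.inr ()) •
            lift fun i => (γ t (Sum.inr ()))⁻¹ * γ t (Sum.inl i) := by
          ext (i | ⟨⟩)
          · simp only [lift, Pi.smul_apply, Sum.elim_inl, smul_eq_mul]
            field_simp
          · simp [lift]
        rw [Pi.zero_apply]
        simp only [hF]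
        have horth : ((α ⬝ᵥ γ t) • ξ - (ξ ⬝ᵥ γ t) • α) ⬝ᵥ
            lift (fun i => (γ t (Sum.inr ()))⁻¹ * γ t (Sum.inl i)) = 0 := by
          have h1 : γ t (Sum.inr ()) * (((α ⬝ᵥ γ t) • ξ - (ξ ⬝ᵥ γ t) • α) ⬝ᵥ
              lift (fun i => (γ t (Sum.inr ()))⁻¹ * γ t (Sum.inl i))) = 0 := by
            rw [← smul_eq_mul, ← dotProduct_smul, ← hlift, sub_dotProduct, smul_dotProduct,
              smul_dotProduct, smul_eq_mul, smul_eq_mul]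
            ring
          exact (mul_eq_zero.mp h1).resolve_left ht.ne'
        have h2 := quadratic_eq_zero_of_cubic_eq_zero (h _ ht') (s := γ t (Sum.inr ())) horth
        rwa [← hlift] at h2) (Set.mem_univ (1 : ℝ))
    simpa [hγ, hF] using hzero
  intro ξ
  by_cases hξ : ξ = 0
  · exact ⟨0, fun M => by simp [hξ]⟩
  have hξξ : ξ ⬝ᵥ ξ ≠ 0 := fun h0 => hξ (dotProduct_self_eq_zero.mp h0)
  have hker : ∀ M, ξ ⬝ᵥ M = 0 → ξ ⬝ᵥ D M *ᵥ ξ = 0 := by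
    intro M hM
    by_cases hM0 : M = 0
    · simp [hM0]
    have hMM : M ⬝ᵥ M ≠ 0 := fun h0 => hM0 (dotProduct_self_eq_zero.mp h0)
    -- With `α = M` and `ξ·M = 0` the test form is `(M·M) ξ`, a nonzero multiple of `ξ`.
    have h1 := key ξ M M
    rw [hM, zero_smul, sub_zero, mulVec_smul, smul_dotProduct, dotProduct_smul, smul_eq_mul,
      smul_eq_mul] at h1
    simpa [hMM] using h1
  refine ⟨(ξ ⬝ᵥ D ξ *ᵥ ξ) / (ξ ⬝ᵥ ξ), fun M => ?_⟩
  -- A linear functional of `M` vanishing on the kernel of `ξ` is a multiple of `ξ`; splitting `M`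
  -- along `ξ` gives the multiple.
  have h1 := hker (M - ((ξ ⬝ᵥ M) / (ξ ⬝ᵥ ξ)) • ξ) (by
    rw [dotProduct_sub, dotProduct_smul, smul_eq_mul]
    field_simp
    ring)
  rw [map_sub, map_smul, sub_mulVec, smul_mulVec, dotProduct_sub, dotProduct_smul, smul_eq_mul,
    sub_eq_zero] at h1
  rw [h1]
  ring

/-- The forms `ξ` such that `ξᵀ L(M) ξ` is a multiple of `ξ(M)`. -/
def specialForms (L : Pencil n) : Set (Fin n ⊕ Unit → ℝ) :=
  {ξ | ∃ c : ℝ, ∀ M, ξ ⬝ᵥ L M *ᵥ ξ = c * (ξ ⬝ᵥ M)}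

/-- There is a special form which is a multiple zero of `ξ ↦ ξ ∧ ξᵀ L(·) ξ`. -/
def HasDegenerateForm (L : Pencil n) : Prop :=
  ∃ (τ : Fin n ⊕ Unit → ℝ) (c : ℝ), τ ≠ 0 ∧ (∀ M, τ ⬝ᵥ L M *ᵥ τ = c * (τ ⬝ᵥ M)) ∧
    ∀ η, ∃ d : ℝ, ∀ M, τ ⬝ᵥ L M *ᵥ η + η ⬝ᵥ L M *ᵥ τ = c * (η ⬝ᵥ M) + d * (τ ⬝ᵥ M)

lemma IsScalar.specialForms_subset {L L' : Pencil n} (h : IsScalar (L' - L)) :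
    specialForms L ⊆ specialForms L' := by
  rintro ξ ⟨c, hc⟩
  obtain ⟨c', hc'⟩ := h ξ
  refine ⟨c' + c, fun M => ?_⟩
  have := hc' M
  rw [LinearMap.sub_apply, sub_mulVec, dotProduct_sub, hc M] at this
  linarith

lemma eq_zero_of_forall_dotProduct {v : Fin n ⊕ Unit → ℝ} (h : ∀ M, v ⬝ᵥ M = 0) : v = 0 :=
  dotProduct_self_eq_zero.mp (h v)

/-- For independent `τ` and `η`, comparing the factors at `τ + η` and `τ - η` shows that the factor
at `τ + η` is the sum of those at `τ` and `η`. This makes degeneracy insensitive to the addition of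
`D`. -/
lemma IsScalar.polar {D : Pencil n} (h : IsScalar D) {τ : Fin n ⊕ Unit → ℝ} (hτ : τ ≠ 0) {c : ℝ}
    (hc : ∀ M, τ ⬝ᵥ D M *ᵥ τ = c * (τ ⬝ᵥ M)) (η : Fin n ⊕ Unit → ℝ) :
    ∃ d : ℝ, ∀ M, τ ⬝ᵥ D M *ᵥ η + η ⬝ᵥ D M *ᵥ τ = c * (η ⬝ᵥ M) + d * (τ ⬝ᵥ M) := by
  by_cases hη : ∃ s : ℝ, η = s • τ
  · obtain ⟨s, rfl⟩ := hη
    refine ⟨s * c, fun M => ?_⟩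
    rw [mulVec_smul, dotProduct_smul, smul_dotProduct, smul_dotProduct, hc M]
    simp only [smul_eq_mul]
    ring
  · obtain ⟨e, he⟩ := h η
    obtain ⟨p, hp⟩ := h (τ + η)
    obtain ⟨q, hq⟩ := h (τ - η)
    have hp' : ∀ M, c * (τ ⬝ᵥ M) + e * (η ⬝ᵥ M) + (τ ⬝ᵥ D M *ᵥ η + η ⬝ᵥ D M *ᵥ τ) =
        p * (τ ⬝ᵥ M + η ⬝ᵥ M) := by
      intro M
      rw [← hc M, ← he M, ← add_dotProduct, ← hp M, mulVec_add, dotProduct_add, add_dotProduct,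
        add_dotProduct]
      ring
    have hq' : ∀ M, c * (τ ⬝ᵥ M) + e * (η ⬝ᵥ M) - (τ ⬝ᵥ D M *ᵥ η + η ⬝ᵥ D M *ᵥ τ) =
        q * (τ ⬝ᵥ M - η ⬝ᵥ M) := by
      intro M
      rw [← hc M, ← he M, ← sub_dotProduct, ← hq M, mulVec_sub, dotProduct_sub, sub_dotProduct,
        sub_dotProduct]
      ring
    have hrel : (2 * c - p - q) • τ + (2 * e - p + q) • η = 0 := by
      refine eq_zero_of_forall_dotProduct fun M => ?_
      rw [add_dotProduct, smul_dotProduct, smul_dotProduct, smul_eq_mul, smul_eq_mul]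
      linarith [hp' M, hq' M]
    have h2 : 2 * e - p + q = 0 := by
      by_contra hne
      refine hη ⟨-((2 * c - p - q) / (2 * e - p + q)), ?_⟩
      have h3 : (2 * e - p + q) • η = -((2 * c - p - q) • τ) := by
        rw [eq_neg_iff_add_eq_zero, add_comm]
        exact hrel
      rw [neg_smul, div_eq_inv_mul, ← smul_smul, ← smul_neg, ← h3, smul_smul, inv_mul_cancel₀ hne,
        one_smul]
    rw [h2, zero_smul, add_zero, smul_eq_zero, or_iff_left hτ] at hrel
    refine ⟨e, fun M => ?_⟩
    have h4 : p = c + e := by linarith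
    have h5 := hp' M
    rw [h4] at h5
    linarith

lemma IsScalar.hasDegenerateForm {L L' : Pencil n} (h : IsScalar (L' - L))
    (hL : HasDegenerateForm L) : HasDegenerateForm L' := by
  obtain ⟨τ, c, hτ, hc, hη⟩ := hL
  obtain ⟨c', hc'⟩ := h τ
  refine ⟨τ, c' + c, hτ, fun M => ?_, fun η => ?_⟩
  · have := hc' M
    rw [LinearMap.sub_apply, sub_mulVec, dotProduct_sub, hc M] at this
    linarith
  · obtain ⟨d, hd⟩ := hη η
    obtain ⟨d', hd'⟩ := h.polar hτ hc' η
    refine ⟨d' + d, fun M => ?_⟩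
    have h1 := hd' M
    have h2 := hd M
    rw [LinearMap.sub_apply, sub_mulVec, sub_mulVec, dotProduct_sub, dotProduct_sub] at h1
    linarith

lemma dotProduct_act (g : G n) (L : Pencil n) (ξ η M : Fin n ⊕ Unit → ℝ) :
    ξ ⬝ᵥ act g L M *ᵥ η =
      ((g⁻¹ : G n).1ᵀ *ᵥ ξ) ⬝ᵥ L (g.1 *ᵥ M) *ᵥ ((g⁻¹ : G n).1ᵀ *ᵥ η) := by
  rw [act_apply, ← mulVec_mulVec, ← mulVec_mulVec, dotProduct_mulVec, ← mulVec_transpose]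

lemma dotProduct_transpose_inv (g : G n) (ξ M : Fin n ⊕ Unit → ℝ) :
    ((g⁻¹ : G n).1ᵀ *ᵥ ξ) ⬝ᵥ (g.1 *ᵥ M) = ξ ⬝ᵥ M := by
  rw [mulVec_transpose, ← dotProduct_mulVec, mulVec_mulVec, ← Units.val_mul, inv_mul_cancel,
    Units.val_one, one_mulVec]

lemma mulVec_inv_mulVec (g : G n) (M : Fin n ⊕ Unit → ℝ) : g.1 *ᵥ ((g⁻¹ : G n).1 *ᵥ M) = M := by
  rw [mulVec_mulVec, ← Units.val_mul, mul_inv_cancel, Units.val_one, one_mulVec]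

lemma transpose_inv_mulVec_injective (g : G n) :
    Function.Injective ((g⁻¹ : G n).1ᵀ).mulVecLin := by
  intro ξ η h
  have h' : (g⁻¹ : G n).1ᵀ *ᵥ ξ = (g⁻¹ : G n).1ᵀ *ᵥ η := h
  have h1 : ∀ v : Fin n ⊕ Unit → ℝ, g.1ᵀ *ᵥ ((g⁻¹ : G n).1ᵀ *ᵥ v) = v := fun v => by
    rw [mulVec_mulVec, ← transpose_mul, ← Units.val_mul, inv_mul_cancel, Units.val_one,
      transpose_one, one_mulVec]
  rw [← h1 ξ, h', h1]

/-- The injective map `ξ ↦ g⁻ᵀ ξ` sends special forms of the transformed pencil to special forms of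
`L`. Equality follows by applying this to `g⁻¹`. -/
lemma finrank_specialForms_act_le (g : G n) (L : Pencil n) :
    Module.finrank ℝ (Submodule.span ℝ (specialForms (act g L))) ≤
      Module.finrank ℝ (Submodule.span ℝ (specialForms L)) := by
  rw [(Submodule.equivMapOfInjective _ (transpose_inv_mulVec_injective g) _).finrank_eq,
    Submodule.map_span]
  refine Submodule.finrank_mono (Submodule.span_mono ?_)
  rintro _ ⟨ξ, ⟨c, hc⟩, rfl⟩
  refine ⟨c, fun M => ?_⟩
  have h1 := hc ((g⁻¹ : G n).1 *ᵥ M)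
  rw [dotProduct_act, ← dotProduct_transpose_inv g ξ ((g⁻¹ : G n).1 *ᵥ M),
    mulVec_inv_mulVec] at h1
  exact h1

lemma finrank_specialForms_act (g : G n) (L : Pencil n) :
    Module.finrank ℝ (Submodule.span ℝ (specialForms (act g L))) =
      Module.finrank ℝ (Submodule.span ℝ (specialForms L)) := by
  refine le_antisymm (finrank_specialForms_act_le g L) ?_
  have := finrank_specialForms_act_le g⁻¹ (act g L)
  rwa [act_act, mul_inv_cancel, act_one] at this

lemma HasDegenerateForm.of_act {g : G n} {L : Pencil n} (h : HasDegenerateForm (act g L)) :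
    HasDegenerateForm L := by
  obtain ⟨τ, c, hτ, hc, hη⟩ := h
  refine ⟨(g⁻¹ : G n).1ᵀ *ᵥ τ, c, fun h0 => hτ ?_, fun M => ?_, fun η => ?_⟩
  · exact transpose_inv_mulVec_injective g (h0.trans (map_zero ((g⁻¹ : G n).1ᵀ).mulVecLin).symm)
  · have h1 := hc ((g⁻¹ : G n).1 *ᵥ M)
    rwa [dotProduct_act, ← dotProduct_transpose_inv g τ ((g⁻¹ : G n).1 *ᵥ M),
      mulVec_inv_mulVec] at h1
  · obtain ⟨d, hd⟩ := hη (g.1ᵀ *ᵥ η)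
    have h2 : (g⁻¹ : G n).1ᵀ *ᵥ (g.1ᵀ *ᵥ η) = η := by
      rw [mulVec_mulVec, ← transpose_mul, ← Units.val_mul, mul_inv_cancel, Units.val_one,
        transpose_one, one_mulVec]
    refine ⟨d, fun M => ?_⟩
    have h1 := hd ((g⁻¹ : G n).1 *ᵥ M)
    rwa [dotProduct_act, dotProduct_act, ← dotProduct_transpose_inv g (g.1ᵀ *ᵥ η)
      ((g⁻¹ : G n).1 *ᵥ M), ← dotProduct_transpose_inv g τ ((g⁻¹ : G n).1 *ᵥ M),
      mulVec_inv_mulVec, h2] at h1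

lemma hasDegenerateForm_act_iff (g : G n) (L : Pencil n) :
    HasDegenerateForm (act g L) ↔ HasDegenerateForm L := by
  refine ⟨fun h => h.of_act, fun h => HasDegenerateForm.of_act (g := g⁻¹) ?_⟩
  rwa [act_act, mul_inv_cancel, act_one]

lemma IsScalar.symm {L L' : Pencil n} (h : IsScalar (L' - L)) : IsScalar (L - L') := by
  intro ξ
  obtain ⟨c, hc⟩ := h ξ
  refine ⟨-c, fun M => ?_⟩
  rw [← neg_sub, LinearMap.neg_apply, neg_mulVec, dotProduct_neg, hc M, neg_mul]

lemma cubic_sub (L L' : Pencil n) (m : Fin n → ℝ) :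
    cubic (L' - L) m = cubic L' m - cubic L m := by
  rw [cubic, LinearMap.sub_apply, Matrix.mul_sub, Matrix.sub_mul, cubic, cubic]

/-- Two orbits which meet have the same invariants. -/
lemma invariants_eq_of_mem_GOrbit [NeZero n] {V V' V₁ : MatrixFunction n} {L L' : Pencil n}
    (hV : ∀ m, V.val m = cubic L m) (hV' : ∀ m, V'.val m = cubic L' m)
    (h : V₁ ∈ GOrbit V) (h' : V₁ ∈ GOrbit V') :
    Module.finrank ℝ (Submodule.span ℝ (specialForms L)) =
        Module.finrank ℝ (Submodule.span ℝ (specialForms L')) ∧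
      (HasDegenerateForm L ↔ HasDegenerateForm L') := by
  obtain ⟨hvar, g, U, hU, hne, hUV, hUg, hT⟩ := h
  obtain ⟨-, g', U', hU', hne', hUV', hUg', hT'⟩ := h'
  -- The open sets `U` and `U'` may be disjoint; only after extension to the whole domain of `V₁`
  -- can the two cubics be compared on `U`.
  have h1 := eq_cubic_of_eq_on_open hvar hU hne hUV (L := act g L) fun m hm => by
    rw [hT m hm, T_eq_cubic (hUg hm).1 (hV _)]
  have h2 := eq_cubic_of_eq_on_open hvar hU' hne' hUV' (L := act g' L') fun m hm => by
    rw [hT' m hm, T_eq_cubic (hUg' hm).1 (hV' _)]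
  have hs : IsScalar (act g' L' - act g L) := isScalar_of_cubic_eq_zero hU hne fun m hm => by
    rw [cubic_sub, ← h1 m (hUV hm), ← h2 m (hUV hm), sub_self]
  constructor
  · rw [← finrank_specialForms_act g L, ← finrank_specialForms_act g' L',
      Set.Subset.antisymm hs.specialForms_subset hs.symm.specialForms_subset]
  · rw [← hasDegenerateForm_act_iff g L, ← hasDegenerateForm_act_iff g' L']
    exact ⟨hs.hasDegenerateForm, hs.symm.hasDegenerateForm⟩

/-! ### The invariants of the types -/

lemma dotProduct_diagPencil (d : (Fin n ⊕ Unit → ℝ) →ₗ[ℝ] (Fin n ⊕ Unit → ℝ))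
    (ξ η M : Fin n ⊕ Unit → ℝ) :
    ξ ⬝ᵥ diagPencil d M *ᵥ η = ∑ a, d M a * (ξ a * η a) := by
  simp only [diagPencil_apply, dotProduct, mulVec_diagonal]
  exact Finset.sum_congr rfl fun a _ => by ring

/-- The special forms need not be a linear space. If they contain the unit vectors indexed by `B`
and are supported in `B`, their span is that coordinate subspace. -/
lemma finrank_span_eq_card {S : Set (Fin n ⊕ Unit → ℝ)} (B : Finset (Fin n ⊕ Unit))
    (hB : ∀ a ∈ B, Pi.single a 1 ∈ S) (hS : ∀ ξ ∈ S, ∀ a, a ∉ B → ξ a = 0) :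
    Module.finrank ℝ (Submodule.span ℝ S) = B.card := by
  have h1 : Submodule.span ℝ S =
      Submodule.span ℝ (Set.range fun a : B => (Pi.single (a : Fin n ⊕ Unit) 1 :
        Fin n ⊕ Unit → ℝ)) := by
    refine le_antisymm (Submodule.span_le.mpr fun ξ hξ => ?_) (Submodule.span_mono ?_)
    · have h2 : ξ = ∑ a ∈ B, ξ a • (Pi.single a 1 : Fin n ⊕ Unit → ℝ) := by
        ext b
        rw [Finset.sum_apply]
        simp only [Pi.smul_apply, Pi.single_apply, smul_eq_mul, mul_ite, mul_one, mul_zero,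
          Finset.sum_ite_eq]
        split_ifs with hb
        · rfl
        · exact hS ξ hξ b hb
      rw [h2]
      exact Submodule.sum_mem _ fun a ha =>
        Submodule.smul_mem _ _ (Submodule.subset_span ⟨⟨a, ha⟩, rfl⟩)
    · rintro _ ⟨a, rfl⟩
      exact hB a a.2
  rw [h1, _root_.finrank_span_eq_card, Fintype.card_coe]
  exact (Pi.linearIndependent_single_one (Fin n ⊕ Unit) ℝ).comp _ Subtype.val_injective

lemma single_mem_specialForms {d : (Fin n ⊕ Unit → ℝ) →ₗ[ℝ] (Fin n ⊕ Unit → ℝ)}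
    {a : Fin n ⊕ Unit} {c : ℝ} (h : ∀ M, d M a = c * M a) :
    Pi.single a 1 ∈ specialForms (diagPencil d) := by
  refine ⟨c, fun M => ?_⟩
  rw [dotProduct_diagPencil, single_one_dotProduct, ← h M, Finset.sum_eq_single a]
  · simp
  · intro b _ hb
    simp [hb]
  · simp

/-- The forms spanned by the special forms of `VI n k`. -/
def supportI (n k : ℕ) : Finset (Fin n ⊕ Unit) :=
  Finset.univ.filter fun a =>
    Sum.elim (fun i : Fin n => decide ((i : ℕ) < k)) (fun _ => true) a = true

lemma finrank_specialForms_diagI (n k : ℕ) :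
    Module.finrank ℝ (Submodule.span ℝ (specialForms (diagPencil (diagI n k)))) =
      (supportI n k).card := by
  refine finrank_span_eq_card _ ?_ ?_
  · rintro (i | ⟨⟩) ha
    · have hi : (i : ℕ) < k := by simpa [supportI] using ha
      exact single_mem_specialForms (c := 1) fun M => by simp [diagI, hi]
    · exact single_mem_specialForms (c := 0) fun M => by simp [diagI]
  · rintro ξ ⟨c, hc⟩ (i | ⟨⟩) ha
    · have hi : ¬ (i : ℕ) < k := by simpa [supportI] using ha
      simp_rw [dotProduct_diagPencil] at hc
      have h1 := hc (Pi.single (Sum.inl i) 1)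
      have h2 := hc (Pi.single (Sum.inr ()) 1)
      have h3 : ∀ j : Fin n, (j : ℕ) < k → j ≠ i := fun j hj h => hi (h ▸ hj)
      rw [dotProduct_single_one, Fintype.sum_sum_type] at h1 h2
      -- For `i ≥ k` the pencil does not involve `Mᵢ`, whence `c ξᵢ = 0`. If `c = 0`, the
      -- coefficient of `M_{n+1}` is the sum of the `ξⱼ²` with `j ≥ k`, and it vanishes.
      have h4 : (0 : ℝ) = c * ξ (Sum.inl i) := by
        rw [← h1]
        simp only [diagI, LinearMap.coe_mk, AddHom.coe_mk, Sum.elim_inl, Sum.elim_inr, zero_mul,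
          Finset.sum_const_zero, add_zero]
        symm
        refine Finset.sum_eq_zero fun j _ => ?_
        split_ifs with hj
        · simp [h3 j hj]
        · simp
      rcases mul_eq_zero.mp h4.symm with h0 | h0
      · rw [h0, zero_mul] at h2
        simp only [diagI, LinearMap.coe_mk, AddHom.coe_mk, Sum.elim_inl, Sum.elim_inr, zero_mul,
          Finset.sum_const_zero, add_zero] at h2
        rw [Finset.sum_eq_zero_iff_of_nonneg] at h2
        · have := h2 i (Finset.mem_univ i)
          simpa [hi] using this
        · intro j _
          refine mul_nonneg ?_ (mul_self_nonneg _)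
          split_ifs <;> simp
      · exact h0
    · simp [supportI] at ha

/-- The last diagonal entry of the pencil is zero, so the last coordinate form lies in the kernel of
every `L(M)`; it is degenerate with both factors zero. -/
lemma hasDegenerateForm_diagI (n k : ℕ) : HasDegenerateForm (diagPencil (diagI n k)) := by
  have h : ∀ (a b M : Fin n ⊕ Unit → ℝ), (∀ i, a (Sum.inl i) * b (Sum.inl i) = 0) →
      a ⬝ᵥ diagPencil (diagI n k) M *ᵥ b = 0 := by
    intro a b M hab
    rw [dotProduct_diagPencil, Fintype.sum_sum_type]
    simp [hab, diagI]
  refine ⟨Pi.single (Sum.inr ()) 1, 0, ?_, fun M => ?_, fun η => ⟨0, fun M => ?_⟩⟩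
  · intro h0
    simpa using congrFun h0 (Sum.inr ())
  · rw [h _ _ _ (by simp), zero_mul]
  · rw [h _ _ _ (by simp), h _ _ _ (by simp)]
    simp

lemma card_supportI_lt {n k l : ℕ} (hl : l ≤ n) (hkl : k < l) :
    (supportI n k).card < (supportI n l).card := by
  refine Finset.card_lt_card ((Finset.ssubset_iff_of_subset ?_).mpr
    ⟨Sum.inl ⟨k, lt_of_lt_of_le hkl hl⟩, ?_, ?_⟩)
  · rintro (i | ⟨⟩) ha
    · have hi : (i : ℕ) < k := by simpa [supportI] using ha
      simpa [supportI] using hi.trans hkl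
    · simp [supportI]
  · simpa [supportI] using hkl
  · simp [supportI]

lemma diagII_single (n : ℕ) (M : Fin n ⊕ Unit → ℝ) (a : Fin n ⊕ Unit) :
    diagII n M a = Sum.elim (fun _ => 1) (fun _ => -1) a * M a := by
  rcases a with i | ⟨⟩ <;> simp [diagII]

lemma finrank_specialForms_diagII (n : ℕ) :
    Module.finrank ℝ (Submodule.span ℝ (specialForms (diagPencil (diagII n)))) =
      (Finset.univ : Finset (Fin n ⊕ Unit)).card :=
  finrank_span_eq_card _ (fun a _ => single_mem_specialForms fun M => diagII_single n M a)
    fun _ _ a ha => absurd (Finset.mem_univ a) ha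

lemma dotProduct_diagII_single (n : ℕ) (ξ η : Fin n ⊕ Unit → ℝ) (a : Fin n ⊕ Unit) :
    ξ ⬝ᵥ diagPencil (diagII n) (Pi.single a 1) *ᵥ η =
      Sum.elim (fun _ => 1) (fun _ => -1) a * (ξ a * η a) := by
  rw [dotProduct_diagPencil, Finset.sum_eq_single a]
  · rw [diagII_single, Pi.single_eq_same, mul_one]
  · intro b _ hb
    rw [diagII_single, Pi.single_eq_of_ne hb, mul_zero, zero_mul]
  · simp

lemma not_hasDegenerateForm_diagII (n : ℕ) [NeZero n] :
    ¬ HasDegenerateForm (diagPencil (diagII n)) := by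
  rintro ⟨τ, c, hτ, hc, hη⟩
  obtain ⟨a, ha⟩ := Function.ne_iff.mp hτ
  rw [Pi.zero_apply] at ha
  have : Nontrivial (Fin n ⊕ Unit) := ⟨Sum.inl 0, Sum.inr (), by simp⟩
  obtain ⟨b, hb⟩ := exists_ne a
  have hc1 : ∀ e, Sum.elim (fun _ => 1) (fun _ => -1) e * (τ e * τ e) = c * τ e := fun e => by
    rw [← dotProduct_diagII_single, hc, dotProduct_single_one]
  have hsq : ∀ e : Fin n ⊕ Unit, (Sum.elim (fun _ => 1) (fun _ => -1) e : ℝ) ≠ 0 := by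
    rintro (i | i) <;> simp
  have hc0 : c ≠ 0 := by
    rintro rfl
    have := hc1 a
    rw [zero_mul] at this
    simp [hsq, ha] at this
  -- With `ε` the signs of the pencil, testing the polar identity for `η = e_b` at `e_a` gives `d =
  -- 0`, and at `e_b` gives `2 ε_b τ_b = c`. Together with `ε_b τ_b² = c τ_b` this forces `τ_b = 0`,
  -- hence `c = 0`, a contradiction.
  obtain ⟨d, hd⟩ := hη (Pi.single b 1)
  have h1 := hd (Pi.single a 1)
  have h2 := hd (Pi.single b 1)
  simp only [dotProduct_diagII_single, dotProduct_single_one, Pi.single_eq_same,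
    Pi.single_eq_of_ne hb.symm, mul_zero, zero_mul, add_zero, zero_add, mul_one, one_mul] at h1 h2
  have hd0 : d = 0 := by simpa [ha] using h1.symm
  rw [hd0, zero_mul, add_zero] at h2
  have h3 := hc1 b
  have h4 : c * τ b = 0 := by
    have : c * τ b = (Sum.elim (fun _ => 1) (fun _ => -1) b * τ b +
      Sum.elim (fun _ => 1) (fun _ => -1) b * τ b) * τ b := by rw [h2]
    linarith
  have h5 : τ b = 0 := by simpa [hc0] using h4
  rw [h5] at h2
  exact hc0 (by simpa using h2.symm)

/-- The last coordinate of `ℝⁿ`. -/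
def lastCoord (n : ℕ) [NeZero n] : Fin n := ⟨n - 1, Nat.sub_lt (Nat.pos_of_ne_zero (NeZero.ne n)) one_pos⟩

lemma not_lt_iff_eq_lastCoord [NeZero n] (i : Fin n) : ¬ (i : ℕ) + 1 < n ↔ i = lastCoord n := by
  have := Nat.pos_of_ne_zero (NeZero.ne n)
  rw [Fin.ext_iff]
  simp only [lastCoord]
  omega

lemma diagV_last [NeZero n] (M : Fin n ⊕ Unit → ℝ) (hM : M = Pi.single (Sum.inl (lastCoord n)) 1) :
    diagV n M = 0 := by
  have h0 : ∀ j : Fin n, (j : ℕ) + 1 < n → M (Sum.inl j) = 0 := by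
    intro j hj
    have : j ≠ lastCoord n := fun h => (not_lt_iff_eq_lastCoord j).mpr h hj
    simp [hM, this]
  have h1 : M (Sum.inr ()) = 0 := by simp [hM]
  have h2 : (∑ j : Fin n, if (j : ℕ) + 1 < n then M (Sum.inl j) else 0) = 0 :=
    Finset.sum_eq_zero fun j _ => by
      split_ifs with hj
      · exact h0 j hj
      · rfl
  ext (i | ⟨⟩)
  · simp only [diagV, LinearMap.coe_mk, AddHom.coe_mk, Sum.elim_inl, Pi.zero_apply, h1, h2]
    split_ifs with hi
    · exact h0 i hi
    · simp
  · simpa [diagV] using h1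

/-- The pencil does not involve the last mean coordinate, so `c ξ_ℓ = 0`. If `c = 0`, the
coefficient of `M_{n+1}` is a sum of nonnegative terms containing `ξ_ℓ²`. -/
lemma specialForms_diagV_last [NeZero n] {ξ : Fin n ⊕ Unit → ℝ} {c : ℝ}
    (hc : ∀ M, ξ ⬝ᵥ diagPencil (diagV n) M *ᵥ ξ = c * (ξ ⬝ᵥ M)) :
    ξ (Sum.inl (lastCoord n)) = 0 := by
  have hl : ¬ ((lastCoord n : Fin n) : ℕ) + 1 < n := (not_lt_iff_eq_lastCoord _).mpr rfl
  simp_rw [dotProduct_diagPencil] at hc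
  have h1 := hc (Pi.single (Sum.inl (lastCoord n)) 1)
  rw [diagV_last _ rfl, dotProduct_single_one] at h1
  simp only [Pi.zero_apply, zero_mul, Finset.sum_const_zero] at h1
  rcases mul_eq_zero.mp h1.symm with h0 | h0
  · have h2 := hc (Pi.single (Sum.inr ()) 1)
    rw [h0, zero_mul, Finset.sum_eq_zero_iff_of_nonneg] at h2
    · have := h2 (Sum.inl (lastCoord n)) (Finset.mem_univ _)
      simpa [diagV, hl] using this
    · rintro (i | ⟨⟩) _
      · refine mul_nonneg ?_ (mul_self_nonneg _)
        simp only [diagV, LinearMap.coe_mk, AddHom.coe_mk, Sum.elim_inl]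
        split_ifs <;> simp
      · refine mul_nonneg ?_ (mul_self_nonneg _)
        simp [diagV]
  · exact h0

lemma finrank_specialForms_diagV (n : ℕ) [NeZero n] :
    Module.finrank ℝ (Submodule.span ℝ (specialForms (diagPencil (diagV n)))) =
      ((Finset.univ : Finset (Fin n ⊕ Unit)).erase (Sum.inl (lastCoord n))).card := by
  refine finrank_span_eq_card _ ?_ ?_
  · rintro (i | ⟨⟩) ha
    · have hi : (i : ℕ) + 1 < n := by
        by_contra h
        rw [not_lt_iff_eq_lastCoord] at h
        simp [h] at ha
      exact single_mem_specialForms (c := 1) fun M => by simp [diagV, hi]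
    · exact single_mem_specialForms (c := 1) fun M => by simp [diagV]
  · rintro ξ ⟨c, hc⟩ a ha
    have : a = Sum.inl (lastCoord n) := by simpa using ha
    rw [this]
    exact specialForms_diagV_last hc

lemma not_hasDegenerateForm_diagV (n : ℕ) [NeZero n] :
    ¬ HasDegenerateForm (diagPencil (diagV n)) := by
  rintro ⟨τ, c, hτ, hc, hη⟩
  have hlast := specialForms_diagV_last hc
  have hc0 : c = 0 := by
    obtain ⟨d, hd⟩ := hη (Pi.single (Sum.inl (lastCoord n)) 1)
    have h1 := hd (Pi.single (Sum.inl (lastCoord n)) 1)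
    rw [dotProduct_diagPencil, dotProduct_diagPencil, diagV_last _ rfl, dotProduct_single_one,
      dotProduct_single_one, hlast] at h1
    simpa using h1.symm
  subst hc0
  refine hτ ?_
  -- At `M = (1, …, 1)` every diagonal entry is positive, so `c = 0` forces `τ = 0`.
  have h1 := hc fun _ => 1
  rw [dotProduct_diagPencil, zero_mul, Finset.sum_eq_zero_iff_of_nonneg] at h1
  · ext a
    have h2 := h1 a (Finset.mem_univ a)
    rcases a with i | ⟨⟩
    · by_cases hi : (i : ℕ) + 1 < n
      · simpa [diagV, hi] using h2
      · rw [(not_lt_iff_eq_lastCoord i).mp hi, hlast]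
        rfl
    · simpa [diagV] using h2
  · rintro (i | ⟨⟩) _
    · refine mul_nonneg ?_ (mul_self_nonneg _)
      simp only [diagV, LinearMap.coe_mk, AddHom.coe_mk, Sum.elim_inl]
      split_ifs
      · exact zero_le_one
      · refine add_nonneg zero_le_one (Finset.sum_nonneg fun j _ => ?_)
        split_ifs <;> simp
    · refine mul_nonneg ?_ (mul_self_nonneg _)
      simp [diagV]

/-! ### Disjointness of the orbits -/

lemma disjoint_GOrbit_VI_VI [NeZero n] {k l : ℕ} (hk : k ≤ n) (hl : l ≤ n) (hkl : k ≠ l) :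
    Disjoint (GOrbit (VI n k)) (GOrbit (VI n l)) := by
  refine Set.disjoint_left.mpr fun V₁ h h' => ?_
  have := (invariants_eq_of_mem_GOrbit (VI_val_eq_cubic n k) (VI_val_eq_cubic n l) h h').1
  rw [finrank_specialForms_diagI, finrank_specialForms_diagI] at this
  rcases lt_or_gt_of_ne hkl with hlt | hlt
  · exact (card_supportI_lt hl hlt).ne this
  · exact (card_supportI_lt hk hlt).ne' this

lemma disjoint_GOrbit_VI_VII [NeZero n] (k : ℕ) :
    Disjoint (GOrbit (VI n k)) (GOrbit (VII n)) :=
  Set.disjoint_left.mpr fun _ h h' => not_hasDegenerateForm_diagII n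
    ((invariants_eq_of_mem_GOrbit (VI_val_eq_cubic n k) (VII_val_eq_cubic n) h h').2.mp
      (hasDegenerateForm_diagI n k))

lemma disjoint_GOrbit_VI_VV [NeZero n] (k : ℕ) :
    Disjoint (GOrbit (VI n k)) (GOrbit (VV n)) :=
  Set.disjoint_left.mpr fun _ h h' => not_hasDegenerateForm_diagV n
    ((invariants_eq_of_mem_GOrbit (VI_val_eq_cubic n k) (VV_val_eq_cubic n) h h').2.mp
      (hasDegenerateForm_diagI n k))

lemma disjoint_GOrbit_VII_VV [NeZero n] : Disjoint (GOrbit (VII n)) (GOrbit (VV n)) := by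
  refine Set.disjoint_left.mpr fun V₁ h h' => ?_
  have := (invariants_eq_of_mem_GOrbit (VII_val_eq_cubic n) (VV_val_eq_cubic n) h h').1
  rw [finrank_specialForms_diagII, finrank_specialForms_diagV] at this
  exact (Finset.card_erase_lt_of_mem (Finset.mem_univ _)).ne' this

lemma GOrbit_subset_morrisMoraClass {V : MatrixFunction n} (hV : V ∈ casalisClass n) :
    GOrbit V ⊆ morrisMoraClass n :=
  fun _ h => ⟨V, hV, h⟩

end SimpleCubic

end

theorem theorem5p4 (n : ℕ) [NeZero n] :
    -- the types belong to the Casalis class, and their orbits lie in the Morris–Mora class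
    ((∀ k : ℕ, k ≤ n → SimpleCubic.VI n k ∈ SimpleCubic.casalisClass n ∧
        SimpleCubic.GOrbit (SimpleCubic.VI n k) ⊆ SimpleCubic.morrisMoraClass n) ∧
      (∀ k : ℕ, 1 ≤ k → k ≤ n → SimpleCubic.VIV n k ∈ SimpleCubic.casalisClass n ∧
        SimpleCubic.GOrbit (SimpleCubic.VIV n k) ⊆ SimpleCubic.morrisMoraClass n) ∧
      (SimpleCubic.VII n ∈ SimpleCubic.casalisClass n ∧
        SimpleCubic.GOrbit (SimpleCubic.VII n) ⊆ SimpleCubic.morrisMoraClass n) ∧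
      (SimpleCubic.VIII n ∈ SimpleCubic.casalisClass n ∧
        SimpleCubic.GOrbit (SimpleCubic.VIII n) ⊆ SimpleCubic.morrisMoraClass n) ∧
      (SimpleCubic.VV n ∈ SimpleCubic.casalisClass n ∧
        SimpleCubic.GOrbit (SimpleCubic.VV n) ⊆ SimpleCubic.morrisMoraClass n)) ∧
    -- `V_{I,k}` and `V_{IV,k}` are in the same orbit
    (∀ k : ℕ, 1 ≤ k → k ≤ n →
      SimpleCubic.VIV n k ∈ SimpleCubic.GOrbit (SimpleCubic.VI n k) ∧
      SimpleCubic.GOrbit (SimpleCubic.VI n k) = SimpleCubic.GOrbit (SimpleCubic.VIV n k)) ∧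
    -- `V_{II}` and `V_{III}` are in the same orbit
    (SimpleCubic.VIII n ∈ SimpleCubic.GOrbit (SimpleCubic.VII n) ∧
      SimpleCubic.GOrbit (SimpleCubic.VII n) = SimpleCubic.GOrbit (SimpleCubic.VIII n)) ∧
    -- the `n + 3` orbits of `V_{I,0}, …, V_{I,n}, V_{II}, V_V` are pairwise disjoint
    (∀ k l : ℕ, k ≤ n → l ≤ n → k ≠ l →
      Disjoint (SimpleCubic.GOrbit (SimpleCubic.VI n k))
        (SimpleCubic.GOrbit (SimpleCubic.VI n l))) ∧
    (∀ k : ℕ, k ≤ n →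
      Disjoint (SimpleCubic.GOrbit (SimpleCubic.VI n k))
        (SimpleCubic.GOrbit (SimpleCubic.VII n)) ∧
      Disjoint (SimpleCubic.GOrbit (SimpleCubic.VI n k))
        (SimpleCubic.GOrbit (SimpleCubic.VV n))) ∧
    Disjoint (SimpleCubic.GOrbit (SimpleCubic.VII n))
      (SimpleCubic.GOrbit (SimpleCubic.VV n)) := by
  have hn : ∀ {V : SimpleCubic.MatrixFunction n}, V ∈ SimpleCubic.casalisClass n →
      V ∈ SimpleCubic.casalisClass n ∧ SimpleCubic.GOrbit V ⊆ SimpleCubic.morrisMoraClass n :=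
    fun h => ⟨h, SimpleCubic.GOrbit_subset_morrisMoraClass h⟩
  exact ⟨⟨fun k _ => hn (SimpleCubic.VI_mem_casalisClass n k),
      fun k hk _ => hn (SimpleCubic.VIV_mem_casalisClass n hk),
      hn (SimpleCubic.VII_mem_casalisClass n), hn (SimpleCubic.VIII_mem_casalisClass n),
      hn (SimpleCubic.VV_mem_casalisClass n)⟩,
    fun k hk _ => ⟨SimpleCubic.VIV_mem_GOrbit_VI hk, SimpleCubic.GOrbit_VI_eq_GOrbit_VIV hk⟩,
    ⟨SimpleCubic.VIII_mem_GOrbit_VII n, SimpleCubic.GOrbit_VII_eq_GOrbit_VIII n⟩,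
    fun k l hk hl hkl => SimpleCubic.disjoint_GOrbit_VI_VI hk hl hkl,
    fun k _ => ⟨SimpleCubic.disjoint_GOrbit_VI_VII k, SimpleCubic.disjoint_GOrbit_VI_VV k⟩,
    SimpleCubic.disjoint_GOrbit_VII_VV⟩
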